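/- Let $\mathfrak h=\mathbb C\langle x,y\rangle$ be the noncommutative polynomial algebra with the bilinear shuffle product ш defined on words by $1\,ш\,w=w\,ш\,1=w$ and $l_1w_1\,ш\,l_2w_2=l_1(w_1\,ш\,l_2w_2)+l_2(l_1w_1\,ш\,w_2)$ for letters $l_1,l_2$ and words $w,w_1,w_2$, and put $\mathfrak h^0=\mathbb C1\oplus x\mathfrak h y$. Let $\widehat\zeta:\mathfrak h^0\to\mathbb C$ be the linear map with $$\widehat\zeta(x^{k_1-1}y\cdots x^{k_m-1}y)=\zeta(k_1,\dots,k_m)=\sum_{n_1>\cdots>n_m>0}\frac1{n_1^{k_1}\cdots n_m^{k_m}},\qquad \widehat\zeta(1)=1 .$$ Let $\mathrm{reg}:\mathfrak h\to\mathfrak h^0$ associate to each element its constant term (the component with $m=n=0$) in the decomposition $\mathfrak h=\bigoplus_{m,n\ge0}y^{ш m}\,ш\,\mathfrak h^0\,ш\,x^{ш n}=\mathfrak h^0[x,y]$. In the algebra $\mathbb C\langle\langle X,Y\rangle\rangle$ of noncommutative formal power series, let $$\varphi_{\mathrm{KZ}}(X,Y)=\sum_W\widehat\zeta(\mathrm{reg}(w))\,W,$$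 where $W$ runs over all words in $X,Y$ and $w$ is the corresponding word in $x,y$. Let $\tau$ be the linear anti-involution of $\mathfrak h$ (for concatenation) with $\tau(x)=y$ and $\tau(y)=x$. Then the Drinfel'd associator $\varphi_{\mathrm{KZ}}$ satisfies $$\varphi_{\mathrm{KZ}}(X,Y)\cdot\varphi_{\mathrm{KZ}}(-Y,-X)=1,$$ and this is equivalent to the generalized duality formula $$\widehat\zeta(\mathrm{reg}(w))=\widehat\zeta(\mathrm{reg}(\tau(w)))\qquad\text{for every word } w \text{ in } x,y .$$ -/

import Mathlib

noncomputable section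

namespace KZ

/-- The two letters `x` and `y` (also used to index the letters `X` and `Y`). -/
inductive Letter : Type
  | x : Letter
  | y : Letter
  deriving DecidableEq

/-- The noncommutative polynomial algebra `𝔥 = ℂ⟨x, y⟩` (with the concatenation product). -/
abbrev Poly : Type := MonoidAlgebra ℂ (FreeMonoid Letter)

/-- The basis of `𝔥` given by the words. -/
def wordBasis : Module.Basis (FreeMonoid Letter) ℂ Poly :=
  MonoidAlgebra.basis (FreeMonoid Letter) ℂ

/-- The word with the given list of letters, as an element of `𝔥`. -/
def word (w : List Letter) : Poly := MonoidAlgebra.single (FreeMonoid.ofList w) 1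

/-- A letter, as an element of `𝔥`. -/
def letter (l : Letter) : Poly := word [l]

/-! ### The shuffle product -/

/-- The shuffle product of two words:
`1 ⧢ w = w ⧢ 1 = w` and `a u ⧢ b v = a (u ⧢ b v) + b (a u ⧢ v)`. -/
def shuffleWord : List Letter → List Letter → Poly
  | [], w => word w
  | a :: u, [] => word (a :: u)
  | a :: u, b :: v =>
      letter a * shuffleWord u (b :: v) + letter b * shuffleWord (a :: u) v
termination_by u v => u.length + v.length

/-- The shuffle product on `𝔥`, the bilinear extension of the shuffle product of words. -/
def shuffle : Poly →ₗ[ℂ] Poly →ₗ[ℂ] Poly :=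
  wordBasis.constr ℂ fun u => wordBasis.constr ℂ fun v =>
    shuffleWord (FreeMonoid.toList u) (FreeMonoid.toList v)

/-- The shuffle power `f ⧢ ⋯ ⧢ f` (`n` factors). -/
def shufflePow (f : Poly) : ℕ → Poly
  | 0 => 1
  | n + 1 => shuffle f (shufflePow f n)

/-! ### The regularization map -/

/-- The subspace `𝔥⁰ = ℂ 1 ⊕ x 𝔥 y`. -/
def h0 : Submodule ℂ Poly :=
  Submodule.span ℂ {1} ⊔
    LinearMap.range (LinearMap.mulLeftRight ℂ (letter Letter.x, letter Letter.y))

/-- The decomposition map: it sends a polynomial in two variables with coefficients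
`c (m, n) ∈ 𝔥⁰` to `∑ y^{⧢ m} ⧢ c (m, n) ⧢ x^{⧢ n}`.  That this map is a bijection is
the decomposition `𝔥 = ⨁ y^{⧢ m} ⧢ 𝔥⁰ ⧢ x^{⧢ n} = 𝔥⁰[x, y]`. -/
def decomp (c : ℕ × ℕ →₀ h0) : Poly :=
  c.sum fun mn f =>
    shuffle (shuffle (shufflePow (letter Letter.y) mn.1) (f : Poly))
      (shufflePow (letter Letter.x) mn.2)

/-- The regularization map `reg : 𝔥 → 𝔥⁰`: the constant term in the decomposition
`𝔥 = 𝔥⁰[x, y]`. -/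
def reg (f : Poly) : h0 := Function.invFun decomp f (0, 0)

/-! ### Multiple zeta values -/

/-- The multiple zeta value
`ζ(k₁, …, k_m) = ∑_{n₁ > ⋯ > n_m > 0} 1 / (n₁^{k₁} ⋯ n_m^{k_m})`. -/
def mzv (k : List ℕ) : ℝ :=
  ∑' n : {n : Fin k.length → ℕ // StrictAnti n ∧ ∀ i, 0 < n i},
    ∏ i : Fin k.length, 1 / ((n.1 i : ℝ) ^ k.get i)

/-- Auxiliary function for `index`; the first argument is the number of letters `x` read
since the last `y`. -/
def indexAux : ℕ → List Letter → List ℕ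
  | _, [] => []
  | j, Letter.x :: w => indexAux (j + 1) w
  | j, Letter.y :: w => (j + 1) :: indexAux 0 w

/-- The index `[k₁, …, k_m]` of the word `x^{k₁-1} y ⋯ x^{k_m-1} y`. -/
def index (w : List Letter) : List ℕ := indexAux 0 w

/-- The linear map `ζ̂ : 𝔥⁰ → ℂ` with `ζ̂(x^{k₁-1} y ⋯ x^{k_m-1} y) = ζ(k₁, …, k_m)`.
Only words in `𝔥⁰` have a nonzero coefficient in an element of `𝔥⁰`. -/
def zetaHat : h0 →ₗ[ℂ] ℂ :=
  (wordBasis.constr ℂ fun w => (mzv (index (FreeMonoid.toList w)) : ℂ)) ∘ₗ h0.subtype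

/-! ### Noncommutative formal power series -/

/-- The algebra `ℌ = ℂ⟨⟨X, Y⟩⟩` of noncommutative formal power series; the series `F` is
`∑_W F(W) W`, where `W` runs over all words in `X` and `Y`. -/
def Series : Type := List Letter → ℂ

namespace Series

instance : AddCommGroup Series := inferInstanceAs (AddCommGroup (List Letter → ℂ))

instance : Module ℂ Series := inferInstanceAs (Module ℂ (List Letter → ℂ))

/-- The unit series, with constant term `1` and no other term. -/
instance : One Series := ⟨fun w => if w = [] then 1 else 0⟩

/-- The product of series induced by concatenation of words: the coefficient of `W` in `F G`
is the sum of `F(U) G(V)` over all factorizations `W = U V`. -/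
instance : Mul Series :=
  ⟨fun F G w => ∑ i ∈ Finset.range (w.length + 1), F (w.take i) * G (w.drop i)⟩

/-- The letter `X` (for `Letter.x`) or `Y` (for `Letter.y`) as a series. -/
def var (l : Letter) : Series := fun w => if w = [l] then 1 else 0

/-- The series `X`. -/
def X : Series := var Letter.x

/-- The series `Y`. -/
def Y : Series := var Letter.y

/-- The value `W(A, B)` of a word `W` at the series `A`, `B`: the product obtained by replacing
each letter `X` by `A` and each letter `Y` by `B`. -/
def evalWord (A B : Series) : List Letter → Series
  | [] => 1
  | Letter.x :: w => A * evalWord A B w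
  | Letter.y :: w => B * evalWord A B w

/-- The substitution `F(A, B) = ∑_W F(W) W(A, B)`, for `A`, `B` without constant term: each
coefficient is then a sum with finitely many nonzero terms. -/
def subst (F A B : Series) : Series :=
  fun v => ∑ᶠ w : List Letter, F w * evalWord A B w v

end Series

/-- The Drinfel'd associator `φ_KZ(X, Y) = ∑_W ζ̂(reg(w)) W`. -/
def phiKZ : Series := fun w => zetaHat (reg (word w))

/-! ### The anti-involution `τ` -/

/-- The exchange `x ↔ y` of the letters. -/
def swap : Letter → Letter
  | Letter.x => Letter.y
  | Letter.y => Letter.x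

/-- The linear anti-involution `τ` of `𝔥` with `τ(x) = y` and `τ(y) = x`: on words it reverses
the order of the letters and exchanges `x` and `y`. -/
def tau : Poly →ₗ[ℂ] Poly :=
  wordBasis.constr ℂ fun w => word ((FreeMonoid.toList w).map swap).reverse

end KZ

end

/-! The functional `zetaReg`, which sends f to ζ̂(reg f), is multiplicative for the shuffle product,
so φ_KZ is group-like. Its inverse is therefore given by the antipode: the coefficient at v is
(-1)^|v| φ_KZ(reversed v) (`antipodeSum_eq_zero`, `phiKZ_mul_antipode`). The coefficient of
φ_KZ(-Y,-X) at v is (-1)^|v| φ_KZ(v with letters exchanged). Cancelling φ_KZ on the left, the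
product relation says exactly that these two families agree, which is duality for the reversed word.
This is `phiKZ_mul_eq_one_iff`, and it does not use duality itself.

Multiplicativity has two sources. Removing a final x and removing an initial y are commuting,
locally nilpotent derivations of the shuffle algebra with slices x and y, and 𝔥⁰ is their common
kernel; hence reg is a homomorphism (`exists_reg_algHom`). On 𝔥⁰, ζ̂ is the value at t = 1 of
polylogarithm power series, whose differential equations match the shuffle recursion
(`polylog_shuffle_word`, `zetaExt_shuffle`).

Duality reduces to 𝔥⁰ because τ exchanges the two slices and preserves 𝔥⁰ (`reg_tau`). There it is
proved by connected sums: with the weight n! m!/(n+m)! coupling two words, a letter can be carried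
from one word to the other, turning into its dual (`connectedSum_transport`). -/

noncomputable section

namespace KZ

variable {M : Type*} [AddCommGroup M] [Module ℂ M]

/-! ### Linear maps on `𝔥` -/

/-- The linear map on `𝔥` with prescribed values on words. -/
def linExt (F : List Letter → M) : Poly →ₗ[ℂ] M :=
  wordBasis.constr ℂ fun w => F (FreeMonoid.toList w)

lemma wordBasis_apply (w : FreeMonoid Letter) : wordBasis w = word (FreeMonoid.toList w) := by
  simp [wordBasis, word]

@[simp] lemma linExt_word (F : List Letter → M) (w : List Letter) :
    linExt F (word w) = F w := by
  have := wordBasis.constr_basis ℂ (fun w => F (FreeMonoid.toList w)) (FreeMonoid.ofList w)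
  rwa [wordBasis_apply] at this

lemma linearMap_ext {f g : Poly →ₗ[ℂ] M} (h : ∀ w, f (word w) = g (word w)) : f = g :=
  wordBasis.ext fun w => by rw [wordBasis_apply]; exact h _

lemma word_nil : word [] = 1 := rfl

lemma word_append (u v : List Letter) : word (u ++ v) = word u * word v := by
  simp [word, MonoidAlgebra.single_mul_single]

lemma word_cons (a : Letter) (w : List Letter) : word (a :: w) = letter a * word w :=
  word_append [a] w

/-- The coefficient of a word, as a linear functional. -/
def wordCoeff (w : List Letter) : Poly →ₗ[ℂ] ℂ := linExt fun v => if v = w then 1 else 0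

lemma wordCoeff_word (w v : List Letter) : wordCoeff w (word v) = if v = w then 1 else 0 := by
  simp [wordCoeff]

lemma wordCoeff_apply (w : List Letter) (f : Poly) :
    wordCoeff w f = wordBasis.repr f (FreeMonoid.ofList w) := by
  have : wordCoeff w = wordBasis.coord (FreeMonoid.ofList w) := by
    refine linearMap_ext fun v => ?_
    have h := wordBasis_apply (FreeMonoid.ofList v)
    rw [FreeMonoid.toList_ofList] at h
    classical
    rw [wordCoeff_word, ← h, Module.Basis.coord_apply, Module.Basis.repr_self,
      Finsupp.single_apply]
    simp
  rw [this, Module.Basis.coord_apply]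

lemma poly_ext {f g : Poly} (h : ∀ w, wordCoeff w f = wordCoeff w g) : f = g := by
  refine wordBasis.ext_elem fun w => ?_
  have := h (FreeMonoid.toList w)
  simpa [wordCoeff_apply] using this

/-- Removal of a first letter `a`. -/
def leftD (a : Letter) : Poly →ₗ[ℂ] Poly :=
  linExt fun
    | [] => 0
    | b :: w => if b = a then word w else 0

/-- Removal of a last letter `a`. -/
def rightD (a : Letter) : Poly →ₗ[ℂ] Poly :=
  linExt fun w => if w.getLast? = some a then word w.dropLast else 0

@[simp] lemma leftD_nil (a : Letter) : leftD a (word []) = 0 := by simp [leftD]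

@[simp] lemma leftD_cons (a b : Letter) (w : List Letter) :
    leftD a (word (b :: w)) = if b = a then word w else 0 := by simp [leftD]

@[simp] lemma leftD_one (a : Letter) : leftD a 1 = 0 := leftD_nil a

@[simp] lemma rightD_nil (a : Letter) : rightD a (word []) = 0 := by simp [rightD]

@[simp] lemma rightD_one (a : Letter) : rightD a 1 = 0 := rightD_nil a

@[simp] lemma rightD_concat (a b : Letter) (w : List Letter) :
    rightD a (word (w ++ [b])) = if b = a then word w else 0 := by simp [rightD]

lemma leftD_letter_mul (a b : Letter) (f : Poly) :
    leftD a (letter b * f) = if b = a then f else 0 := by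
  have : leftD a ∘ₗ LinearMap.mulLeft ℂ (letter b) =
      if b = a then LinearMap.id else 0 := by
    refine linearMap_ext fun w => ?_
    simp only [LinearMap.comp_apply, LinearMap.mulLeft_apply, ← word_cons, leftD_cons]
    split_ifs <;> simp
  have h := LinearMap.congr_fun this f
  simp only [LinearMap.comp_apply, LinearMap.mulLeft_apply] at h
  rw [h]
  split_ifs <;> simp

lemma wordCoeff_cons (a : Letter) (w : List Letter) (f : Poly) :
    wordCoeff (a :: w) f = wordCoeff w (leftD a f) := by
  have : wordCoeff (a :: w) = wordCoeff w ∘ₗ leftD a := by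
    refine linearMap_ext fun v => ?_
    cases v with
    | nil => simp [wordCoeff_word]
    | cons b v =>
      by_cases h : b = a <;> simp [wordCoeff_word, h]
  rw [this, LinearMap.comp_apply]

lemma wordCoeff_nil_letter_mul (b : Letter) (f : Poly) :
    wordCoeff [] (letter b * f) = 0 := by
  have : wordCoeff [] ∘ₗ LinearMap.mulLeft ℂ (letter b) = 0 := by
    refine linearMap_ext fun w => ?_
    simp [← word_cons, wordCoeff_word]
  exact LinearMap.congr_fun this f

/-- Every element of `𝔥` is determined by its constant term and its left derivatives. -/
lemma eq_of_leftD {f g : Poly} (h0 : wordCoeff [] f = wordCoeff [] g)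
    (h : ∀ a, leftD a f = leftD a g) : f = g := by
  refine poly_ext fun w => ?_
  cases w with
  | nil => exact h0
  | cons a w => rw [wordCoeff_cons, wordCoeff_cons, h]

lemma leftD_rightD (a b : Letter) (f : Poly) : leftD a (rightD b f) = rightD b (leftD a f) := by
  have : leftD a ∘ₗ rightD b = rightD b ∘ₗ leftD a := by
    refine linearMap_ext fun w => ?_
    rcases w.eq_nil_or_concat' with rfl | ⟨v, c, rfl⟩
    · simp
    · cases v with
      | nil =>
        have := rightD_concat b c []
        simp only [List.nil_append] at this
        simp only [LinearMap.comp_apply, List.nil_append, this, leftD_cons]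
        split_ifs <;> simp
      | cons d v =>
        simp only [LinearMap.comp_apply, rightD_concat]
        simp only [List.cons_append, leftD_cons]
        split_ifs <;> simp [*]
  exact LinearMap.congr_fun this f

/-- Both sides read off the coefficient of the one-letter word a. -/
lemma wordCoeff_nil_rightD (a : Letter) (f : Poly) :
    wordCoeff [] (rightD a f) = wordCoeff [] (leftD a f) := by
  have : wordCoeff [] ∘ₗ rightD a = wordCoeff [] ∘ₗ leftD a := by
    refine linearMap_ext fun w => ?_
    rcases w.eq_nil_or_concat' with rfl | ⟨v, c, rfl⟩
    · simp
    · cases v with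
      | nil =>
        have := rightD_concat a c []
        simp only [List.nil_append] at this
        simp [this]
      | cons d v =>
        simp only [LinearMap.comp_apply, rightD_concat]
        simp only [List.cons_append, leftD_cons]
        split_ifs <;> simp [wordCoeff_word]
  exact LinearMap.congr_fun this f

/-! ### The shuffle product -/

lemma shuffle_word (u v : List Letter) : shuffle (word u) (word v) = shuffleWord u v := by
  have h : shuffle = linExt fun u => linExt fun v => shuffleWord u v := rfl
  rw [h, linExt_word, linExt_word]

/-- A bilinear identity on `𝔥` may be checked on words. -/
lemma bilin_ext {f g : Poly →ₗ[ℂ] Poly →ₗ[ℂ] M}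
    (h : ∀ u v, f (word u) (word v) = g (word u) (word v)) (p q : Poly) : f p q = g p q := by
  have : f = g := linearMap_ext fun u => linearMap_ext fun v => h u v
  rw [this]

lemma one_shuffle (f : Poly) : shuffle 1 f = f := by
  have : shuffle 1 = LinearMap.id := by
    refine linearMap_ext fun w => ?_
    rw [← word_nil, shuffle_word, shuffleWord, LinearMap.id_apply]
  rw [this, LinearMap.id_apply]

lemma shuffle_one (f : Poly) : shuffle f 1 = f := by
  have : shuffle.flip 1 = LinearMap.id := by
    refine linearMap_ext fun w => ?_
    rw [← word_nil, LinearMap.flip_apply, shuffle_word, LinearMap.id_apply]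
    cases w <;> rw [shuffleWord]
  exact LinearMap.congr_fun this f

/-- The recursion defining the shuffle says that the first letter comes from one factor or the
other. This Leibniz rule lets shuffle identities be checked coefficient by coefficient, by induction
on the word read off. -/
lemma leftD_shuffle (a : Letter) (f g : Poly) :
    leftD a (shuffle f g) = shuffle (leftD a f) g + shuffle f (leftD a g) := by
  refine bilin_ext (f := shuffle.compr₂ (leftD a))
    (g := shuffle.comp (leftD a) + shuffle.compl₂ (leftD a)) (fun u v => ?_) f g
  simp only [LinearMap.compr₂_apply, LinearMap.add_apply, LinearMap.comp_apply,
    LinearMap.compl₂_apply]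
  cases u with
  | nil => simp [word_nil, one_shuffle]
  | cons b u =>
    cases v with
    | nil => simp [word_nil, shuffle_one]
    | cons c v =>
      rw [shuffle_word, shuffleWord, map_add, leftD_letter_mul, leftD_letter_mul, leftD_cons,
        leftD_cons]
      split_ifs <;> simp [shuffle_word]

lemma wordCoeff_nil_shuffle (f g : Poly) :
    wordCoeff [] (shuffle f g) = wordCoeff [] f * wordCoeff [] g := by
  refine bilin_ext (f := shuffle.compr₂ (wordCoeff []))
    (g := (LinearMap.mul ℂ ℂ).compl₁₂ (wordCoeff []) (wordCoeff [])) (fun u v => ?_) f g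
  simp only [LinearMap.compr₂_apply, LinearMap.compl₁₂_apply, LinearMap.mul_apply']
  cases u with
  | nil => rw [word_nil, one_shuffle, ← word_nil, wordCoeff_word]; simp [wordCoeff_word]
  | cons b u =>
    cases v with
    | nil => rw [word_nil, shuffle_one, ← word_nil, wordCoeff_word, wordCoeff_word]; simp
    | cons c v =>
      rw [shuffle_word, shuffleWord, map_add, wordCoeff_nil_letter_mul, wordCoeff_nil_letter_mul]
      simp [wordCoeff_word]

lemma shuffle_comm (f g : Poly) : shuffle f g = shuffle g f := by
  refine poly_ext fun w => ?_
  induction w generalizing f g with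
  | nil => rw [wordCoeff_nil_shuffle, wordCoeff_nil_shuffle, mul_comm]
  | cons a w ih =>
    simp only [wordCoeff_cons, leftD_shuffle, map_add]
    rw [ih, ih f, add_comm]

lemma shuffle_assoc (f g h : Poly) :
    shuffle (shuffle f g) h = shuffle f (shuffle g h) := by
  refine poly_ext fun w => ?_
  induction w generalizing f g h with
  | nil => simp only [wordCoeff_nil_shuffle, mul_assoc]
  | cons a w ih =>
    simp only [wordCoeff_cons, leftD_shuffle, map_add, LinearMap.add_apply, ih, add_assoc]

/-- The recursion does not see last letters; the rule follows from the left one because the two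
removals commute and agree at constant terms. -/
lemma rightD_shuffle (a : Letter) (f g : Poly) :
    rightD a (shuffle f g) = shuffle (rightD a f) g + shuffle f (rightD a g) := by
  refine poly_ext fun w => ?_
  induction w generalizing f g with
  | nil =>
    simp only [wordCoeff_nil_rightD, leftD_shuffle, map_add, wordCoeff_nil_shuffle]
  | cons b w ih =>
    simp only [wordCoeff_cons, leftD_shuffle, map_add, leftD_rightD, ih]
    abel

/-! ### The anti-involution and the shuffle product -/

lemma tau_word (w : List Letter) : tau (word w) = word (w.map swap).reverse := by
  have h : tau = linExt fun w => word (w.map swap).reverse := rfl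
  rw [h, linExt_word]

lemma swap_swap (a : Letter) : swap (swap a) = a := by cases a <;> rfl

lemma swap_eq_iff (a b : Letter) : swap a = b ↔ a = swap b := by
  cases a <;> cases b <;> simp [swap]

lemma tau_tau (f : Poly) : tau (tau f) = f := by
  have : tau ∘ₗ tau = LinearMap.id := by
    refine linearMap_ext fun w => ?_
    simp [tau_word, Function.comp_def, swap_swap]
  exact LinearMap.congr_fun this f

lemma leftD_tau (a : Letter) (f : Poly) : leftD a (tau f) = tau (rightD (swap a) f) := by
  have : leftD a ∘ₗ tau = tau ∘ₗ rightD (swap a) := by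
    refine linearMap_ext fun w => ?_
    rcases w.eq_nil_or_concat' with rfl | ⟨v, c, rfl⟩
    · simp [tau_word]
    · simp only [LinearMap.comp_apply, rightD_concat, tau_word, List.map_append,
        List.reverse_append, List.map_cons, List.map_nil, List.reverse_cons, List.reverse_nil,
        List.nil_append, List.cons_append, leftD_cons, swap_eq_iff]
      split_ifs <;> simp [tau_word]
  exact LinearMap.congr_fun this f

lemma wordCoeff_nil_tau (f : Poly) : wordCoeff [] (tau f) = wordCoeff [] f := by
  have : wordCoeff [] ∘ₗ tau = wordCoeff [] := by
    refine linearMap_ext fun w => ?_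
    simp [tau_word, wordCoeff_word]
  exact LinearMap.congr_fun this f

lemma tau_shuffle (f g : Poly) : tau (shuffle f g) = shuffle (tau f) (tau g) := by
  refine poly_ext fun w => ?_
  induction w generalizing f g with
  | nil => simp only [wordCoeff_nil_tau, wordCoeff_nil_shuffle]
  | cons b w ih =>
    simp only [wordCoeff_cons, leftD_shuffle, map_add, leftD_tau, rightD_shuffle, ih]

/-! ### The antipode identity -/

/-- The alternating sum `∑_{w = u v} (-1)^{|v|} u ⧢ v'` with `v'` the reversal of `v`. -/
def antipodeSum (w : List Letter) : Poly :=
  ∑ i ∈ Finset.range (w.length + 1),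
    (-1 : ℂ) ^ (w.length - i) • shuffle (word (w.take i)) (word (w.drop i).reverse)

/-- In each term the prefix starts with b and the reversed suffix starts with c. Leibniz thus gives
the sums for the word without its first and without its last letter, the latter with a minus sign
because its suffix is one letter shorter. -/
lemma leftD_antipodeSum (a b c : Letter) (w v : List Letter) (h : b :: w = v ++ [c]) :
    leftD a (antipodeSum (b :: w)) =
      (if b = a then antipodeSum w else 0) - if c = a then antipodeSum v else 0 := by
  have hl : w.length = v.length := by simpa using congrArg List.length h
  simp only [antipodeSum, map_sum, map_smul, leftD_shuffle, smul_add, Finset.sum_add_distrib]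
  rw [sub_eq_add_neg]
  congr 1
  · rw [Finset.sum_range_succ']
    simp only [List.length_cons, List.take_succ_cons, List.drop_succ_cons, leftD_cons,
      List.take_zero, leftD_nil, map_zero, LinearMap.zero_apply, smul_zero, add_zero,
      Nat.add_sub_add_right]
    split_ifs <;> simp
  · rw [Finset.sum_range_succ, h]
    simp only [List.length_append, List.length_cons, List.length_nil, zero_add]
    rw [List.drop_of_length_le (by simp), List.reverse_nil, leftD_nil, map_zero, smul_zero,
      add_zero]
    have : ∀ i ∈ Finset.range (v.length + 1),
        (-1 : ℂ) ^ (v.length + 1 - i) • shuffle (word ((v ++ [c]).take i))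
          (leftD a (word ((v ++ [c]).drop i).reverse)) =
        if c = a then -((-1 : ℂ) ^ (v.length - i) • shuffle (word (v.take i))
          (word (v.drop i).reverse)) else 0 := by
      intro i hi
      have hi : i ≤ v.length := Nat.lt_succ_iff.mp (Finset.mem_range.mp hi)
      rw [List.take_append_of_le_length hi, List.drop_append_of_le_length hi,
        List.reverse_append, Nat.sub_add_comm hi, pow_succ]
      simp only [List.reverse_cons, List.reverse_nil, List.nil_append, List.cons_append,
        leftD_cons]
      split_ifs <;> simp
    rw [Finset.sum_congr rfl this]
    split_ifs <;> simp

lemma antipodeSum_eq_zero (w : List Letter) (hw : w ≠ []) : antipodeSum w = 0 := by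
  induction hn : w.length using Nat.strong_induction_on generalizing w with
  | _ n ih =>
    obtain ⟨b, w, rfl⟩ := List.exists_cons_of_ne_nil hw
    obtain ⟨v, c, h⟩ := (b :: w).eq_nil_or_concat'.resolve_left hw
    have hl : w.length = v.length := by simpa using congrArg List.length h
    refine eq_of_leftD ?_ fun a => ?_
    · rw [antipodeSum, map_sum, map_zero]
      refine Finset.sum_eq_zero fun i hi => ?_
      rw [map_smul, wordCoeff_nil_shuffle, wordCoeff_word, wordCoeff_word]
      rcases i with _ | i <;> simp
    · rw [leftD_antipodeSum a b c w v h, map_zero]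
      simp only [List.length_cons] at hn
      rcases w.eq_nil_or_concat' with rfl | ⟨w', d, rfl⟩
      -- For a single letter the remaining sums belong to the empty word and do not vanish, but they
      -- cancel.
      · obtain rfl : v = [] := List.length_eq_zero_iff.mp hl.symm
        obtain rfl : b = c := by simpa using h
        rw [sub_self]
      · rw [ih _ (by omega) (w' ++ [d]) (by simp) rfl, ih _ (by omega) v (by
          rintro rfl; simp at hl) hl.symm]
        simp

/-! ### Locally nilpotent derivations with a slice -/

section Slice

variable {A : Type*} [CommRing A] [Algebra ℂ A]

/-- The constants of a derivation. -/
def constants (D : Derivation ℂ A A) : Subalgebra ℂ A where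
  carrier := {f | D f = 0}
  mul_mem' {f g} hf hg := by
    simp only [Set.mem_ofPred_eq] at *
    simp [hf, hg]
  add_mem' {f g} hf hg := by
    simp only [Set.mem_ofPred_eq] at *
    simp [hf, hg]
  algebraMap_mem' r := by simp

lemma mem_constants {D : Derivation ℂ A A} {f : A} : f ∈ constants D ↔ D f = 0 := Iff.rfl

open Polynomial

lemma derivation_aeval (D : Derivation ℂ A A) {s : A} (hs : D s = 1) (p : (constants D)[X]) :
    D (aeval s p) = aeval s (derivative p) := by
  induction p using Polynomial.induction_on' with
  | add p q hp hq => simp only [map_add, hp, hq]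
  | monomial n a =>
    have ha : D (a : A) = 0 := mem_constants.mp a.2
    have hC : ∀ b : constants D, algebraMap (constants D) A b = (b : A) := fun b => rfl
    simp only [aeval_monomial, derivative_monomial, Derivation.leibniz, hC, ha,
      Derivation.leibniz_pow, hs, smul_eq_mul, nsmul_eq_mul]
    push_cast
    ring

/-- Applying D to a relation p(s) = 0 gives p'(s) = 0, of lower degree; so p' = 0, and in
characteristic zero p is a constant polynomial. -/
lemma aeval_slice_injective (D : Derivation ℂ A A) {s : A} (hs : D s = 1) :
    Function.Injective (aeval s : (constants D)[X] →ₐ[constants D] A) := by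
  have : IsAddTorsionFree (constants D) := by
    have := Module.compHom (constants D) (algebraMap ℚ ℂ)
    exact IsAddTorsionFree.of_module_rat _
  rw [injective_iff_map_eq_zero]
  intro p hp
  induction hn : p.natDegree using Nat.strong_induction_on generalizing p with
  | _ n ih =>
    have hd : aeval s (derivative p) = 0 := by rw [← derivation_aeval D hs, hp, map_zero]
    have hp' : derivative p = 0 := by
      by_cases h0 : p.natDegree = 0
      · rw [eq_C_of_natDegree_eq_zero h0, derivative_C]
      · exact ih _ (hn ▸ natDegree_derivative_lt h0) _ hd rfl
    have h0 := derivative_eq_zero.mp hp'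
    rw [eq_C_of_natDegree_eq_zero h0] at hp ⊢
    rw [aeval_C] at hp
    have : p.coeff 0 = 0 := Subtype.ext hp
    rw [this, C_0]

lemma exists_derivative_eq {K : Type*} [CommRing K] [Algebra ℂ K] (p : K[X]) :
    ∃ q, derivative q = p := by
  induction p using Polynomial.induction_on' with
  | add p q hp hq =>
    obtain ⟨p', rfl⟩ := hp
    obtain ⟨q', rfl⟩ := hq
    exact ⟨p' + q', derivative_add⟩
  | monomial n a =>
    refine ⟨monomial (n + 1) (((n : ℂ) + 1)⁻¹ • a), ?_⟩
    rw [derivative_monomial, Nat.add_sub_cancel]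
    congr 1
    have h : ((n : ℂ) + 1) ≠ 0 := Nat.cast_add_one_ne_zero n
    have h2 : ((n + 1 : ℕ) : K) = algebraMap ℂ K ((n : ℂ) + 1) := by simp
    rw [h2, mul_comm, ← Algebra.smul_def, smul_smul, mul_inv_cancel₀ h, one_smul]

/-- If D f is a polynomial in s, then f differs from a formal antiderivative evaluated at s by a
constant of D. -/
lemma aeval_slice_surjective (D : Derivation ℂ A A) {s : A} (hs : D s = 1)
    (hD : ∀ f, ∃ n, D^[n] f = 0) :
    Function.Surjective (aeval s : (constants D)[X] →ₐ[constants D] A) := by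
  intro f
  obtain ⟨n, hn⟩ := hD f
  induction n generalizing f with
  | zero => exact ⟨0, by rw [map_zero]; exact hn.symm⟩
  | succ n ih =>
    obtain ⟨p, hp⟩ := ih (D f) hn
    obtain ⟨q, rfl⟩ := exists_derivative_eq p
    have hc : f - aeval s q ∈ constants D := by
      rw [mem_constants, map_sub, derivation_aeval D hs, hp, sub_self]
    refine ⟨q + C ⟨_, hc⟩, ?_⟩
    rw [map_add, aeval_C]
    change aeval s q + (f - aeval s q) = f
    ring

/-- A locally nilpotent derivation with a slice `s` has a retraction onto its constants that
kills `s`. -/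
lemma exists_retraction (D : Derivation ℂ A A) {s : A} (hs : D s = 1)
    (hD : ∀ f, ∃ n, D^[n] f = 0) :
    ∃ π : A →ₐ[ℂ] A, π s = 0 ∧ ∀ f, D f = 0 → π f = f := by
  let e := AlgEquiv.ofBijective (aeval s : (constants D)[X] →ₐ[constants D] A)
    ⟨aeval_slice_injective D hs, aeval_slice_surjective D hs hD⟩
  let π := (aeval (0 : A) : (constants D)[X] →ₐ[constants D] A).comp
    (e.symm : A →ₐ[constants D] (constants D)[X])
  refine ⟨π.restrictScalars ℂ, ?_, fun f hf => ?_⟩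
  · have : e.symm s = X := by
      rw [AlgEquiv.symm_apply_eq]
      exact (aeval_X s).symm
    simp [π, this]
  · have : e.symm f = C ⟨f, hf⟩ := by
      rw [AlgEquiv.symm_apply_eq]
      exact (aeval_C s (⟨f, hf⟩ : constants D)).symm
    simp only [π, AlgHom.restrictScalars_apply, AlgHom.comp_apply, AlgEquiv.coe_toAlgHom, this,
      aeval_C]
    rfl

lemma iterate_pow_mul (D : Derivation ℂ A A) {s : A} (hs : D s = 1) (n : ℕ) {g : A}
    (hg : D g = 0) : D^[n] (s ^ n * g) = (n.factorial : ℂ) • g := by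
  induction n with
  | zero => simp
  | succ n ih =>
    have h : D (s ^ (n + 1) * g) = ((n : ℂ) + 1) • (s ^ n * g) := by
      rw [Derivation.leibniz, hg, smul_zero, zero_add, Derivation.leibniz_pow, hs,
        Nat.add_sub_cancel, smul_eq_mul, smul_eq_mul, mul_one, nsmul_eq_mul, Algebra.smul_def]
      simp only [Nat.cast_add, Nat.cast_one, map_add, map_natCast, map_one]
      ring
    rw [Function.iterate_succ_apply, h]
    have h2 : ∀ (c : ℂ) (f : A), D^[n] (c • f) = c • D^[n] f := fun c f => by
      simp only [← Derivation.coeFn_coe, ← Module.End.pow_apply, map_smul]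
    rw [h2, ih, smul_smul, Nat.factorial_succ]
    push_cast
    rfl

/-- The constants and the slice generate: a relative version for submodules. -/
lemma le_of_slice (D : Derivation ℂ A A) {s : A} (hs : D s = 1) (hD : ∀ f, ∃ n, D^[n] f = 0)
    {V W : Submodule ℂ A} (hVD : ∀ f ∈ V, D f ∈ V) (hVs : ∀ f ∈ V, s * f ∈ V)
    (hVW : ∀ f ∈ V, D f = 0 → f ∈ W) (hWs : ∀ f ∈ W, s * f ∈ W) : V ≤ W := by
  intro f hf
  obtain ⟨n, hn⟩ := hD f
  induction n generalizing f with
  | zero =>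
    have hn : f = 0 := hn
    rw [hn]
    exact W.zero_mem
  | succ n ih =>
    have hpow : ∀ (U : Submodule ℂ A), (∀ f ∈ U, s * f ∈ U) → ∀ m : ℕ, ∀ f ∈ U, s ^ m * f ∈ U := by
      intro U hU m
      induction m with
      | zero => intro f hf; simpa using hf
      | succ m ihm =>
        intro f hf
        rw [pow_succ', mul_assoc]
        exact hU _ (ihm f hf)
    have hit : ∀ m : ℕ, D^[m] f ∈ V := by
      intro m
      induction m with
      | zero => exact hf
      | succ m ihm => rw [Function.iterate_succ_apply']; exact hVD _ ihm
    set g := D^[n] f with hg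
    have hDg : D g = 0 := by rw [hg, ← Function.iterate_succ_apply' D, hn]
    have hgW : g ∈ W := hVW g (hit n) hDg
    -- The top Taylor term of f in the slice; subtracting it lowers the order of nilpotency.
    set r := ((n.factorial : ℂ)⁻¹) • (s ^ n * g) with hr
    have hfac : (n.factorial : ℂ) ≠ 0 := Nat.cast_ne_zero.mpr n.factorial_ne_zero
    have hrD : D^[n] (f - r) = 0 := by
      have h2 : ∀ f : A, D^[n] f = ((D : A →ₗ[ℂ] A) ^ n) f := fun f => by
        rw [Module.End.pow_apply, Derivation.coeFn_coe]
      rw [h2, map_sub, hr, map_smul, ← h2, ← h2, iterate_pow_mul D hs n hDg, smul_smul,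
        inv_mul_cancel₀ hfac, one_smul, ← hg, sub_self]
    have hrV : r ∈ V := V.smul_mem _ (hpow V hVs n g (hit n))
    have hrW : r ∈ W := W.smul_mem _ (hpow W hWs n g hgW)
    have := ih (V.sub_mem hf hrV) hrD
    simpa using W.add_mem this hrW

end Slice

/-! ### The shuffle algebra -/

/-- The space `𝔥` with the shuffle product. -/
def ShuffleAlgebra : Type := Poly

namespace ShuffleAlgebra

instance : AddCommGroup ShuffleAlgebra := inferInstanceAs (AddCommGroup Poly)

instance : Module ℂ ShuffleAlgebra := inferInstanceAs (Module ℂ Poly)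

instance : CommRing ShuffleAlgebra :=
  { (inferInstance : AddCommGroup ShuffleAlgebra) with
    mul := fun f g => shuffle f g
    one := (1 : Poly)
    mul_assoc := shuffle_assoc
    mul_comm := shuffle_comm
    one_mul := one_shuffle
    mul_one := shuffle_one
    zero_mul := fun f => LinearMap.map_zero₂ shuffle f
    mul_zero := fun f => map_zero (shuffle f)
    left_distrib := fun f g h => map_add (shuffle f) g h
    right_distrib := fun f g h => LinearMap.map_add₂ shuffle f g h }

instance : Algebra ℂ ShuffleAlgebra :=
  Algebra.ofModule (fun r f g => LinearMap.map_smul₂ shuffle r f g)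
    (fun r f g => map_smul (shuffle f) r g)

end ShuffleAlgebra

/-- The identity map from `𝔥` to its shuffle algebra. -/
def toSh : Poly ≃ₗ[ℂ] ShuffleAlgebra := LinearEquiv.refl ℂ Poly

lemma toSh_shuffle (f g : Poly) : toSh (shuffle f g) = toSh f * toSh g := rfl

lemma toSh_one : toSh 1 = 1 := rfl

lemma toSh_shufflePow (f : Poly) (n : ℕ) : toSh (shufflePow f n) = toSh f ^ n := by
  induction n with
  | zero => rw [pow_zero]; rfl
  | succ n ih => rw [shufflePow, toSh_shuffle, ih, pow_succ']

/-- Removal of a first letter, as a derivation of the shuffle algebra. -/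
def leftDer (a : Letter) : Derivation ℂ ShuffleAlgebra ShuffleAlgebra :=
  Derivation.mk' (leftD a) fun (f g : Poly) =>
    show leftD a (shuffle f g) = shuffle f (leftD a g) + shuffle g (leftD a f) by
      rw [leftD_shuffle, shuffle_comm g, add_comm]

/-- Removal of a last letter, as a derivation of the shuffle algebra. -/
def rightDer (a : Letter) : Derivation ℂ ShuffleAlgebra ShuffleAlgebra :=
  Derivation.mk' (rightD a) fun (f g : Poly) =>
    show rightD a (shuffle f g) = shuffle f (rightD a g) + shuffle g (rightD a f) by
      rw [rightD_shuffle, shuffle_comm g, add_comm]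

lemma leftDer_toSh (a : Letter) (f : Poly) : leftDer a (toSh f) = toSh (leftD a f) := rfl

lemma rightDer_toSh (a : Letter) (f : Poly) : rightDer a (toSh f) = toSh (rightD a f) := rfl

/-- A property of elements of `𝔥` stable under linear combinations may be checked on words. -/
lemma poly_induction {P : Poly → Prop} (f : Poly) (word : ∀ w, P (word w))
    (add : ∀ f g, P f → P g → P (f + g)) (smul : ∀ (c : ℂ) f, P f → P (c • f)) : P f := by
  have hf : f ∈ Submodule.span ℂ (Set.range wordBasis) := by
    rw [wordBasis.span_eq]; trivial
  induction hf using Submodule.span_induction with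
  | mem g hg =>
    obtain ⟨w, rfl⟩ := hg
    rw [wordBasis_apply]
    exact word _
  | zero => simpa using smul 0 _ (word [])
  | add f g _ _ hf hg => exact add f g hf hg
  | smul c f _ hf => exact smul c f hf

lemma locally_nilpotent (D : Poly →ₗ[ℂ] Poly)
    (h : ∀ w, ∃ n, ((D ^ n) (word w)) = 0) (f : Poly) :
    ∃ n, (D ^ n) f = 0 := by
  have hle : ∀ {m n : ℕ} {f : Poly}, m ≤ n → (D ^ m) f = 0 → (D ^ n) f = 0 := by
    intro m n f hmn hf
    obtain ⟨k, rfl⟩ := Nat.exists_eq_add_of_le' hmn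
    rw [pow_add, Module.End.mul_apply, hf, map_zero]
  refine poly_induction (P := fun f => ∃ n, (D ^ n) f = 0) f h ?_ ?_
  · rintro f g ⟨m, hm⟩ ⟨n, hn⟩
    exact ⟨max m n, by rw [map_add, hle (le_max_left _ _) hm, hle (le_max_right _ _) hn, add_zero]⟩
  · rintro c f ⟨n, hn⟩
    exact ⟨n, by rw [map_smul, hn, smul_zero]⟩

lemma leftDer_nilpotent (a : Letter) (f : ShuffleAlgebra) : ∃ n, (leftDer a)^[n] f = 0 := by
  obtain ⟨n, hn⟩ := locally_nilpotent (leftD a) (fun w => by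
    induction w with
    | nil => exact ⟨1, by simp⟩
    | cons b w ih =>
      obtain ⟨n, hn⟩ := ih
      refine ⟨n + 1, ?_⟩
      rw [pow_succ, Module.End.mul_apply, leftD_cons]
      split_ifs
      · exact hn
      · exact map_zero _) f
  exact ⟨n, (Module.End.pow_apply _ n _).symm.trans hn⟩

lemma rightDer_nilpotent (a : Letter) (f : ShuffleAlgebra) : ∃ n, (rightDer a)^[n] f = 0 := by
  obtain ⟨n, hn⟩ := locally_nilpotent (rightD a) (fun w => by
    induction w using List.reverseRecOn with
    | nil => exact ⟨1, by simp⟩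
    | append_singleton w b ih =>
      obtain ⟨n, hn⟩ := ih
      refine ⟨n + 1, ?_⟩
      rw [pow_succ, Module.End.mul_apply, rightD_concat]
      split_ifs
      · exact hn
      · exact map_zero _) f
  exact ⟨n, (Module.End.pow_apply _ n _).symm.trans hn⟩

/-! ### The subspace `𝔥⁰` -/

lemma eq_sum_leftD (f : Poly) :
    f = wordCoeff [] f • 1 + letter .x * leftD .x f + letter .y * leftD .y f := by
  refine poly_induction (P := fun f =>
    f = wordCoeff [] f • 1 + letter .x * leftD .x f + letter .y * leftD .y f) f ?_ ?_ ?_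
  · intro w
    rcases w with _ | ⟨_ | _, w⟩ <;> simp [wordCoeff_word, ← word_nil, ← word_cons]
  · intro f g hf hg
    simp only [map_add, mul_add, add_smul]
    nth_rewrite 1 [hf, hg]
    abel
  · intro c f hf
    simp only [map_smul, mul_smul_comm, smul_eq_mul, mul_smul, ← smul_add]
    rw [← hf]

lemma eq_sum_rightD (f : Poly) :
    f = wordCoeff [] f • 1 + rightD .x f * letter .x + rightD .y f * letter .y := by
  refine poly_induction (P := fun f =>
    f = wordCoeff [] f • 1 + rightD .x f * letter .x + rightD .y f * letter .y) f ?_ ?_ ?_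
  · intro w
    rcases w.eq_nil_or_concat' with rfl | ⟨w, _ | _, rfl⟩
    · simp [wordCoeff_word, ← word_nil]
    · simp [wordCoeff_word, letter, ← word_append]
    · simp [wordCoeff_word, letter, ← word_append]
  · intro f g hf hg
    simp only [map_add, add_mul, add_smul]
    nth_rewrite 1 [hf, hg]
    abel
  · intro c f hf
    simp only [map_smul, smul_mul_assoc, smul_eq_mul, mul_smul, ← smul_add]
    rw [← hf]

/-- Expressing 𝔥⁰ as a common kernel of derivations makes it visibly a shuffle subalgebra and fits
it to the slice argument. -/
lemma mem_h0_iff (f : Poly) : f ∈ h0 ↔ leftD .y f = 0 ∧ rightD .x f = 0 := by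
  constructor
  · intro hf
    obtain ⟨g, hg, h, hh, rfl⟩ := Submodule.mem_sup.mp hf
    obtain ⟨c, rfl⟩ := Submodule.mem_span_singleton.mp hg
    obtain ⟨p, rfl⟩ := hh
    have hr : rightD .x (letter .x * p * letter .y) = 0 := by
      refine poly_induction (P := fun p => rightD .x (letter .x * p * letter .y) = 0) p ?_ ?_ ?_
      · intro w
        rw [letter, letter, ← word_append, ← word_append, rightD_concat, if_neg (by simp)]
      · intro f g hf hg
        rw [mul_add, add_mul, map_add, hf, hg, add_zero]
      · intro c f hf
        rw [mul_smul_comm, smul_mul_assoc, map_smul, hf, smul_zero]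
    rw [LinearMap.mulLeftRight_apply]
    refine ⟨?_, ?_⟩
    · simp [mul_assoc, leftD_letter_mul]
    · simp [hr]
  · rintro ⟨hl, hr⟩
    have h1 := eq_sum_leftD f
    have h2 := eq_sum_rightD (leftD .x f)
    rw [← leftD_rightD, hr, map_zero, ← wordCoeff_nil_rightD, hr, map_zero, zero_smul, zero_mul,
      zero_add, zero_add] at h2
    rw [hl, mul_zero, add_zero, h2, ← mul_assoc] at h1
    rw [h1]
    refine Submodule.add_mem_sup (Submodule.smul_mem _ _ (Submodule.mem_span_singleton_self _)) ?_
    exact ⟨rightD .y (leftD .x f), rfl⟩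

lemma tau_mem_h0 {f : Poly} (hf : f ∈ h0) : tau f ∈ h0 := by
  rw [mem_h0_iff] at hf ⊢
  refine ⟨by rw [leftD_tau, swap, hf.2, map_zero], ?_⟩
  have h := leftD_tau .y (tau f)
  rw [tau_tau, hf.1] at h
  rw [← tau_tau (rightD .x (tau f))]
  exact (congrArg tau h.symm).trans (map_zero tau)

lemma shuffle_mem_h0 {f g : Poly} (hf : f ∈ h0) (hg : g ∈ h0) : shuffle f g ∈ h0 := by
  rw [mem_h0_iff] at *
  simp [leftD_shuffle, rightD_shuffle, hf, hg]

/-! ### The regularization map -/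

/-- The generators `y^{⧢ m} ⧢ g ⧢ x^{⧢ n}` with `g ∈ 𝔥⁰`. -/
def regGenerators : Set ShuffleAlgebra :=
  {f | ∃ m n : ℕ, ∃ g ∈ h0, f = toSh (letter .y) ^ m * toSh g * toSh (letter .x) ^ n}

lemma leftD_letter (a b : Letter) : leftD a (letter b) = if b = a then 1 else 0 :=
  leftD_cons a b []

lemma rightD_letter (a b : Letter) : rightD a (letter b) = if b = a then 1 else 0 :=
  rightD_concat a b []

lemma leftDer_slice : leftDer .y (toSh (letter .y)) = 1 := by
  rw [leftDer_toSh, leftD_letter, if_pos rfl, toSh_one]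

lemma rightDer_slice : rightDer .x (toSh (letter .x)) = 1 := by
  rw [rightDer_toSh, rightD_letter, if_pos rfl, toSh_one]

lemma rightDer_x_letter_y : rightDer .x (toSh (letter .y)) = 0 := by
  rw [rightDer_toSh, rightD_letter, if_neg (by simp), map_zero]

lemma leftDer_rightDer (a b : Letter) (f : ShuffleAlgebra) :
    leftDer a (rightDer b f) = rightDer b (leftDer a f) :=
  leftD_rightD a b (toSh.symm f)

lemma mem_h0_iff_toSh (f : Poly) :
    f ∈ h0 ↔ leftDer .y (toSh f) = 0 ∧ rightDer .x (toSh f) = 0 := by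
  rw [mem_h0_iff, leftDer_toSh, rightDer_toSh, map_eq_zero_iff _ toSh.injective,
    map_eq_zero_iff _ toSh.injective]

/-- The slice argument is used twice: with y inside the constants of `rightDer .x`, where the
remaining constants form 𝔥⁰, then with x on the whole algebra. -/
lemma span_regGenerators : Submodule.span ℂ regGenerators = ⊤ := by
  set W := Submodule.span ℂ regGenerators with hW
  have hmul : ∀ s : ShuffleAlgebra, (∀ f ∈ regGenerators, s * f ∈ regGenerators) →
      ∀ f ∈ W, s * f ∈ W := by
    intro s hs f hf
    induction hf using Submodule.span_induction with
    | mem f hf => exact Submodule.subset_span (hs f hf)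
    | zero => rw [mul_zero]; exact W.zero_mem
    | add f g _ _ hf hg => rw [mul_add]; exact W.add_mem hf hg
    | smul c f _ hf => rw [mul_smul_comm]; exact W.smul_mem c hf
  have hx := hmul (toSh (letter .x)) (by
    rintro _ ⟨m, n, g, hg, rfl⟩
    exact ⟨m, n + 1, g, hg, by rw [pow_succ]; ring⟩)
  have hy := hmul (toSh (letter .y)) (by
    rintro _ ⟨m, n, g, hg, rfl⟩
    exact ⟨m + 1, n, g, hg, by rw [pow_succ]; ring⟩)
  have hV : (constants (rightDer .x)).toSubmodule ≤ W := by
    refine le_of_slice (leftDer .y) leftDer_slice (leftDer_nilpotent .y) ?_ ?_ ?_ hy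
    · intro f hf
      have hf : rightDer .x f = 0 := hf
      change rightDer .x (leftDer .y f) = 0
      rw [← leftDer_rightDer, hf, map_zero]
    · intro f hf
      exact Subalgebra.mul_mem (constants (rightDer .x)) rightDer_x_letter_y hf
    · intro f hf hf'
      obtain ⟨f, rfl⟩ := toSh.surjective f
      exact Submodule.subset_span ⟨0, 0, f, (mem_h0_iff_toSh f).mpr ⟨hf', hf⟩, by simp⟩
  exact top_le_iff.mp (le_of_slice (rightDer .x) rightDer_slice (rightDer_nilpotent .x)
    (fun _ _ => trivial) (fun _ _ => trivial) (fun f _ hf => hV hf) hx)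

lemma toSh_decomp (c : ℕ × ℕ →₀ h0) : toSh (decomp c) =
    c.sum fun mn g => toSh (letter .y) ^ mn.1 * toSh g * toSh (letter .x) ^ mn.2 := by
  simp only [decomp, map_finsuppSum, toSh_shuffle, toSh_shufflePow]

lemma decomp_surjective : Function.Surjective decomp := by
  intro f
  suffices h : ∃ c, toSh (decomp c) = toSh f from h.imp fun c hc => toSh.injective hc
  have hf : toSh f ∈ Submodule.span ℂ regGenerators := by
    rw [span_regGenerators]; trivial
  generalize toSh f = F at hf ⊢
  induction hf using Submodule.span_induction with
  | mem f hf =>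
    obtain ⟨m, n, g, hg, rfl⟩ := hf
    refine ⟨Finsupp.single (m, n) ⟨g, hg⟩, ?_⟩
    rw [toSh_decomp, Finsupp.sum_single_index (by simp)]
  | zero => exact ⟨0, by rw [toSh_decomp, Finsupp.sum_zero_index]⟩
  | add f g _ _ hf hg =>
    obtain ⟨c, rfl⟩ := hf
    obtain ⟨d, rfl⟩ := hg
    refine ⟨c + d, ?_⟩
    simp only [toSh_decomp]
    rw [Finsupp.sum_add_index' (by simp) (by simp [mul_add, add_mul])]
  | smul r f _ hf =>
    obtain ⟨c, rfl⟩ := hf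
    refine ⟨r • c, ?_⟩
    simp only [toSh_decomp]
    rw [Finsupp.sum_smul_index' (by simp), Finsupp.smul_sum]
    simp

/-- The regularization map is a homomorphism of shuffle algebras; it kills both letters and fixes
`𝔥⁰`. -/
lemma exists_reg_algHom : ∃ R : ShuffleAlgebra →ₐ[ℂ] ShuffleAlgebra,
    R (toSh (letter .x)) = 0 ∧ R (toSh (letter .y)) = 0 ∧ (∀ g ∈ h0, R (toSh g) = toSh g) ∧
      ∀ f : Poly, toSh (reg f) = R (toSh f) := by
  obtain ⟨π, hπx, hπ⟩ := exists_retraction (rightDer .x) rightDer_slice (rightDer_nilpotent .x)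
  obtain ⟨ρ, hρy, hρ⟩ := exists_retraction (leftDer .y) leftDer_slice (leftDer_nilpotent .y)
  have hx : ρ.comp π (toSh (letter .x)) = 0 := by rw [AlgHom.comp_apply, hπx, map_zero]
  have hy : ρ.comp π (toSh (letter .y)) = 0 := by
    rw [AlgHom.comp_apply, hπ _ rightDer_x_letter_y, hρy]
  have hg : ∀ g ∈ h0, ρ.comp π (toSh g) = toSh g := by
    intro g hg
    rw [mem_h0_iff_toSh] at hg
    rw [AlgHom.comp_apply, hπ _ hg.2, hρ _ hg.1]
  refine ⟨ρ.comp π, hx, hy, hg, fun f => ?_⟩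
  -- Injectivity of `decomp` is not needed: the homomorphism recovers the (0,0) entry of any
  -- preimage of f, so the choice made by `invFun` is harmless.
  have hf : decomp (Function.invFun decomp f) = f := Function.invFun_eq (decomp_surjective f)
  rw [reg]
  set c := Function.invFun decomp f
  rw [← hf, toSh_decomp, map_finsuppSum]
  simp only [map_mul, map_pow, hx, hy]
  rw [Finsupp.sum, Finset.sum_eq_single ((0, 0) : ℕ × ℕ)]
  · simp only [pow_zero, one_mul, mul_one, hg _ (c (0, 0)).2]
  · rintro ⟨m, n⟩ _ hmn
    rcases m with _ | m
    · rcases n with _ | n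
      · exact absurd rfl hmn
      · simp
    · simp
  · intro h0
    rw [Finsupp.notMem_support_iff.mp h0]
    simp

lemma reg_shuffle (f g : Poly) : (reg (shuffle f g) : Poly) = shuffle (reg f) (reg g) := by
  obtain ⟨R, -, -, -, hR⟩ := exists_reg_algHom
  apply toSh.injective
  rw [toSh_shuffle, hR, hR, hR, toSh_shuffle, map_mul]

lemma reg_linear (r : ℂ) (f g : Poly) : reg (r • f + g) = r • reg f + reg g := by
  obtain ⟨R, -, -, -, hR⟩ := exists_reg_algHom
  apply Subtype.ext
  apply toSh.injective
  simp only [hR, map_add, map_smul, Submodule.coe_add, Submodule.coe_smul]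

lemma reg_of_mem_h0 {f : Poly} (hf : f ∈ h0) : (reg f : Poly) = f := by
  obtain ⟨R, -, -, hg, hR⟩ := exists_reg_algHom
  apply toSh.injective
  rw [hR, hg f hf]

/-- The anti-involution as an endomorphism of the shuffle algebra. -/
def tauHom : ShuffleAlgebra →ₐ[ℂ] ShuffleAlgebra :=
  AlgHom.ofLinearMap tau (tau_word []) tau_shuffle

lemma tauHom_toSh (f : Poly) : tauHom (toSh f) = toSh (tau f) := rfl

lemma reg_tau (f : Poly) : (reg (tau f) : Poly) = tau (reg f) := by
  obtain ⟨R, hx, hy, hg, hR⟩ := exists_reg_algHom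
  apply toSh.injective
  rw [hR, ← tauHom_toSh, ← tauHom_toSh, hR]
  have hf : toSh f ∈ Submodule.span ℂ regGenerators := by
    rw [span_regGenerators]; trivial
  have tx : tau (letter .x) = letter .y := tau_word [.x]
  have ty : tau (letter .y) = letter .x := tau_word [.y]
  generalize toSh f = F at hf ⊢
  induction hf using Submodule.span_induction with
  | mem f hf =>
    obtain ⟨m, n, g, hg', rfl⟩ := hf
    simp only [map_mul, map_pow, tauHom_toSh, hx, hy, tx, ty, hg _ hg', hg _ (tau_mem_h0 hg'),
      map_zero]
  | zero => simp only [map_zero]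
  | add f g _ _ hf hg => simp only [map_add, hf, hg]
  | smul r f _ hf => simp only [map_smul, hf]

open scoped NNReal ENNReal

/-! ### Coefficients of multiple polylogarithms -/

/-- The `n`-th Taylor coefficient of the multiple polylogarithm of a word ending in `y`. -/
def polylogCoeff : List Letter → ℕ → ℝ≥0
  | [], n => if n = 0 then 1 else 0
  | Letter.x :: w, n => polylogCoeff w n / n
  | Letter.y :: w, n => (∑ m ∈ Finset.range n, polylogCoeff w m) / n

lemma polylogCoeff_zero (w : List Letter) : polylogCoeff w 0 = if w = [] then 1 else 0 := by
  rcases w with _ | ⟨_ | _, w⟩ <;> simp [polylogCoeff]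

lemma polylogCoeff_zero_of_ne {w : List Letter} (hw : w ≠ []) : polylogCoeff w 0 = 0 := by
  rw [polylogCoeff_zero, if_neg hw]

/-! ### Duality by connected sums -/

/-- The connector `n! m! / (n + m)!`. -/
def connector (n m : ℕ) : ℝ≥0 := (n.factorial * m.factorial : ℝ≥0) / (n + m).factorial

lemma connector_comm (n m : ℕ) : connector n m = connector m n := by
  rw [connector, connector, mul_comm, add_comm]

lemma connector_zero_right (n : ℕ) : connector n 0 = 1 := by
  have : ((n.factorial : ℕ) : ℝ≥0) ≠ 0 := Nat.cast_ne_zero.mpr n.factorial_ne_zero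
  simp [connector, this]

lemma connector_telescope {n : ℕ} (hn : n ≠ 0) (m : ℕ) :
    (connector n (m + 1) : ℝ) / ((m + 1 : ℕ) : ℝ) =
      (connector n m : ℝ) / n - (connector n (m + 1) : ℝ) / n := by
  have h1 : ((n + m).factorial : ℝ) ≠ 0 := Nat.cast_ne_zero.mpr (Nat.factorial_ne_zero _)
  have h2 : (n : ℝ) ≠ 0 := Nat.cast_ne_zero.mpr hn
  have h3 : ((m : ℝ) + 1) ≠ 0 := Nat.cast_add_one_ne_zero m
  have h4 : ((n : ℝ) + m + 1) ≠ 0 := by positivity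
  simp only [connector, NNReal.coe_div, NNReal.coe_mul, NNReal.coe_natCast, ← add_assoc,
    Nat.factorial_succ]
  push_cast
  field_simp
  ring

lemma connector_le (n m : ℕ) (hn : n ≠ 0) :
    (connector n m : ℝ) ≤ n.factorial * (1 / ((m : ℝ) + 1)) := by
  have h1 : (0 : ℝ) < m.factorial := Nat.cast_pos.mpr (Nat.factorial_pos _)
  have h2 : ((m + 1).factorial : ℝ) ≤ (n + m).factorial :=
    Nat.cast_le.mpr (Nat.factorial_le (by omega))
  have h3 : (0 : ℝ) < (m + 1).factorial := Nat.cast_pos.mpr (Nat.factorial_pos _)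
  simp only [connector, NNReal.coe_div, NNReal.coe_mul, NNReal.coe_natCast]
  calc (n.factorial * m.factorial : ℝ) / (n + m).factorial
      ≤ (n.factorial * m.factorial : ℝ) / (m + 1).factorial := by gcongr
    _ = n.factorial * (1 / ((m : ℝ) + 1)) := by
      rw [Nat.factorial_succ]
      push_cast
      field_simp

/-- The sum telescopes. This trades a factor 1/n on one side for a strict summation with factor 1/b
on the other, as in the coefficients of x-words and y-words. -/
lemma hasSum_connector {n : ℕ} (hn : n ≠ 0) (m : ℕ) :
    HasSum (fun k => connector n (m + 1 + k) / ((m + 1 + k : ℕ) : ℝ≥0)) (connector n m / n) := by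
  rw [← NNReal.hasSum_coe]
  rw [hasSum_iff_tendsto_nat_of_nonneg (fun i => NNReal.coe_nonneg _)]
  have hsum : ∀ K, ∑ k ∈ Finset.range K,
      ((connector n (m + 1 + k) / ((m + 1 + k : ℕ) : ℝ≥0) : ℝ≥0) : ℝ) =
      (connector n m : ℝ) / n - (connector n (m + K) : ℝ) / n := by
    intro K
    induction K with
    | zero => simp
    | succ K ih =>
      rw [Finset.sum_range_succ, ih, add_right_comm m 1 K, NNReal.coe_div, NNReal.coe_natCast,
        connector_telescope hn, ← add_assoc]
      ring
  simp only [hsum]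
  have hlim : Filter.Tendsto (fun K : ℕ => (connector n (m + K) : ℝ)) Filter.atTop (nhds 0) := by
    have h := (tendsto_one_div_add_atTop_nhds_zero_nat (𝕜 := ℝ)).const_mul (n.factorial : ℝ)
    rw [mul_zero] at h
    refine squeeze_zero (fun _ => NNReal.coe_nonneg _) (fun K => ?_) h
    refine (connector_le n (m + K) hn).trans ?_
    gcongr
    exact Nat.cast_le.mpr (Nat.le_add_left K m)
  have := (hlim.div_const (n : ℝ)).const_sub ((connector n m : ℝ) / n)
  simpa using this

lemma tsum_connector {n : ℕ} (hn : n ≠ 0) (m : ℕ) :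
    ∑' k, ((connector n (m + 1 + k) / ((m + 1 + k : ℕ) : ℝ≥0) : ℝ≥0) : ℝ≥0∞) =
      ((connector n m / n : ℝ≥0) : ℝ≥0∞) :=
  (ENNReal.hasSum_coe.mpr (hasSum_connector hn m)).tsum_eq

lemma tsum_if_lt (m : ℕ) (G : ℕ → ℝ≥0∞) :
    ∑' b, (if m < b then G b else 0) = ∑' k, G (m + 1 + k) := by
  rw [← ENNReal.summable.sum_add_tsum_nat_add' (f := fun b => if m < b then G b else 0)
    (k := m + 1)]
  rw [Finset.sum_eq_zero, zero_add]
  · refine tsum_congr fun k => ?_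
    rw [if_pos (by omega), add_comm k]
  · intro i hi
    rw [if_neg (by have := Finset.mem_range.mp hi; omega)]

lemma tsum_sum_range (F : ℕ → ℕ → ℝ≥0∞) :
    ∑' b, ∑ m ∈ Finset.range b, F m b = ∑' m, ∑' k, F m (m + 1 + k) := by
  have h : ∀ b, ∑ m ∈ Finset.range b, F m b = ∑' m, if m < b then F m b else 0 := by
    intro b
    rw [tsum_eq_sum (s := Finset.range b) (fun m hm => if_neg (by simpa using hm))]
    exact Finset.sum_congr rfl fun m hm => (if_pos (Finset.mem_range.mp hm)).symm
  simp only [h]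
  rw [ENNReal.tsum_comm]
  exact tsum_congr fun m => tsum_if_lt m (F m)

/-- The connected sum of two words. -/
def connectedSum (u v : List Letter) : ℝ≥0∞ :=
  ∑' n, ∑' m, ((polylogCoeff u n * polylogCoeff v m * connector n m : ℝ≥0) : ℝ≥0∞)

lemma connectedSum_comm (u v : List Letter) : connectedSum u v = connectedSum v u := by
  rw [connectedSum, connectedSum, ENNReal.tsum_comm]
  refine tsum_congr fun n => tsum_congr fun m => ?_
  rw [connector_comm, mul_comm (polylogCoeff u m)]

/-- An initial x contributes 1/n, which `tsum_connector` converts into the summation of an initial y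
across the connector. The hypothesis on u kills the n = 0 terms, where the telescoping fails. Values
in `ℝ≥0∞` make all interchanges of sums free of convergence conditions. -/
lemma connectedSum_x_cons {u : List Letter} (hu : u ≠ []) (v : List Letter) :
    connectedSum (.x :: u) v = connectedSum u (.y :: v) := by
  refine tsum_congr fun n => ?_
  rcases eq_or_ne n 0 with rfl | hn
  · simp [polylogCoeff, polylogCoeff_zero_of_ne hu]
  · have h : ∀ b, ((polylogCoeff u n * polylogCoeff (.y :: v) b * connector n b : ℝ≥0) : ℝ≥0∞) =
        ∑ m ∈ Finset.range b, ((polylogCoeff u n * polylogCoeff v m : ℝ≥0) : ℝ≥0∞) *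
          ((connector n b / (b : ℝ≥0) : ℝ≥0) : ℝ≥0∞) := by
      intro b
      rw [← Finset.sum_mul, ← ENNReal.ofNNReal_finsetSum, ← Finset.mul_sum, ← ENNReal.coe_mul,
        polylogCoeff]
      congr 1
      ring
    simp only [h]
    rw [tsum_sum_range (fun m b => ((polylogCoeff u n * polylogCoeff v m : ℝ≥0) : ℝ≥0∞) *
          ((connector n b / (b : ℝ≥0) : ℝ≥0) : ℝ≥0∞))]
    refine tsum_congr fun m => ?_
    rw [ENNReal.tsum_mul_left, tsum_connector hn, ← ENNReal.coe_mul, polylogCoeff]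
    congr 1
    ring

lemma connectedSum_y_cons (u : List Letter) {v : List Letter} (hv : v ≠ []) :
    connectedSum (.y :: u) v = connectedSum u (.x :: v) := by
  rw [connectedSum_comm, connectedSum_comm u, connectedSum_x_cons hv]

lemma connectedSum_transport (u : List Letter) {v : List Letter} (hv : v ≠ []) :
    connectedSum (u ++ [.y]) v = connectedSum [] (((u ++ [Letter.y]).map swap).reverse ++ v) := by
  induction u generalizing v with
  | nil => exact connectedSum_y_cons [] hv
  | cons a u ih =>
    cases a with
    | x =>
      rw [List.cons_append, connectedSum_x_cons (by simp), ih (by simp)]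
      simp [swap]
    | y =>
      rw [List.cons_append, connectedSum_y_cons _ hv, ih (by simp)]
      simp [swap]

lemma connectedSum_nil_right (w : List Letter) :
    connectedSum w [] = ∑' n, (polylogCoeff w n : ℝ≥0∞) := by
  refine tsum_congr fun n => ?_
  rw [tsum_eq_single 0 (fun m hm => by simp [polylogCoeff, hm])]
  simp [polylogCoeff, connector_zero_right]

lemma tsum_polylogCoeff_dual (u : List Letter) :
    ∑' n, (polylogCoeff (.x :: u ++ [.y]) n : ℝ≥0∞) =
      ∑' n, (polylogCoeff ((Letter.x :: u ++ [Letter.y]).map swap).reverse n : ℝ≥0∞) := by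
  rw [← connectedSum_nil_right, ← connectedSum_nil_right, List.cons_append,
    connectedSum_x_cons (by simp), connectedSum_transport _ (by simp), connectedSum_comm]
  simp [swap]

/-! ### Multiple zeta values as sums of coefficients -/

/-- The tuples indexing the multiple zeta series of `k`. -/
abbrev MzvTuple (k : List ℕ) : Type :=
  {n : Fin k.length → ℕ // StrictAnti n ∧ ∀ i, 0 < n i}

/-- The first entry of a tuple, and `0` for the empty tuple. -/
def MzvTuple.head {k : List ℕ} (t : MzvTuple k) : ℕ :=
  if h : 0 < k.length then t.1 ⟨0, h⟩ else 0

/-- The term of the multiple zeta series. -/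
def MzvTuple.term {k : List ℕ} (t : MzvTuple k) : ℝ≥0 :=
  ∏ i : Fin k.length, 1 / ((t.1 i : ℝ≥0) ^ k.get i)

/-- The sum of the terms of the multiple zeta series whose first entry is `n`. -/
def mzvCoeff : List ℕ → ℕ → ℝ≥0
  | [], n => if n = 0 then 1 else 0
  | k :: ks, n => (∑ m ∈ Finset.range n, mzvCoeff ks m) / (n : ℝ≥0) ^ k

lemma strictAnti_cons_iff {n m : ℕ} (f : Fin m → ℕ) :
    StrictAnti (Fin.cons n f : Fin (m + 1) → ℕ) ↔
      (∀ h : 0 < m, f ⟨0, h⟩ < n) ∧ StrictAnti f := by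
  constructor
  · intro h
    refine ⟨fun hm => ?_, fun i j hij => ?_⟩
    · exact @h 0 (Fin.succ ⟨0, hm⟩) (Fin.succ_pos _)
    · have := h (Fin.succ_lt_succ_iff.mpr hij)
      simpa using this
  · rintro ⟨h, hf⟩ i j hij
    induction j using Fin.cases with
    | zero => exact absurd hij (Fin.not_lt_zero i)
    | succ j =>
      induction i using Fin.cases with
      | zero =>
        simp only [Fin.cons_zero, Fin.cons_succ]
        exact (hf.antitone (Fin.mk_le_mk.mpr (Nat.zero_le _) :
          (⟨0, j.pos⟩ : Fin m) ≤ j)).trans_lt (h j.pos)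
      | succ i =>
        simp only [Fin.cons_succ]
        exact hf (Fin.succ_lt_succ_iff.mp hij)

/-- Splitting off the first entry of a tuple. -/
def MzvTuple.consEquiv (k : ℕ) (ks : List ℕ) :
    {p : ℕ × MzvTuple ks // p.2.head < p.1} ≃ MzvTuple (k :: ks) where
  toFun p := ⟨(Fin.cons p.1.1 p.1.2.1 : Fin (ks.length + 1) → ℕ), by
    obtain ⟨⟨n, t, ht, ht0⟩, hp⟩ := p
    refine ⟨(strictAnti_cons_iff _).mpr ⟨fun h => ?_, ht⟩, fun i => ?_⟩
    · simpa [head, h] using hp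
    · induction i using Fin.cases with
      | zero => exact Nat.zero_lt_of_lt hp
      | succ i => exact ht0 i⟩
  invFun t := ⟨⟨t.1 (0 : Fin (ks.length + 1)), ⟨fun i => t.1 (Fin.succ i), by
    refine ⟨fun i j hij => t.2.1 (Fin.succ_lt_succ_iff.mpr hij), fun i => t.2.2 _⟩⟩⟩, by
    simp only [head]
    split_ifs with h
    · exact t.2.1 (Fin.succ_pos ⟨0, h⟩)
    · exact t.2.2 _⟩
  left_inv p := rfl
  right_inv t := Subtype.ext (Fin.cons_self_tail (α := fun _ => ℕ) t.1)

/-- The weight g is there for the induction: it is specialised to the indicator of head < n when the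
first entry is split off. -/
lemma tsum_mzvTuple (k : List ℕ) (g : ℕ → ℝ≥0∞) :
    ∑' t : MzvTuple k, (t.term : ℝ≥0∞) * g t.head = ∑' n, (mzvCoeff k n : ℝ≥0∞) * g n := by
  induction k generalizing g with
  | nil =>
    have : Unique (MzvTuple []) :=
      { default := ⟨fun i => i.elim0, fun i => i.elim0, fun i => i.elim0⟩
        uniq := fun t => Subtype.ext (funext fun i => i.elim0) }
    rw [tsum_eq_single default (fun t ht => absurd (Unique.uniq _ t) ht),
      tsum_eq_single 0 (fun n hn => by simp [mzvCoeff, hn])]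
    simp [mzvCoeff, MzvTuple.term, MzvTuple.head]
  | cons k ks ih =>
    rw [← (MzvTuple.consEquiv k ks).tsum_eq]
    have hterm : ∀ p : {p : ℕ × MzvTuple ks // p.2.head < p.1},
        (((MzvTuple.consEquiv k ks p).term : ℝ≥0) : ℝ≥0∞) *
          g (MzvTuple.consEquiv k ks p).head =
        (fun p : ℕ × MzvTuple ks => ((1 / (p.1 : ℝ≥0) ^ k : ℝ≥0) : ℝ≥0∞) * g p.1 *
          (p.2.term : ℝ≥0∞)) p := by
      intro p
      have h1 : (MzvTuple.consEquiv k ks p).term = 1 / (p.1.1 : ℝ≥0) ^ k * p.1.2.term :=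
        Fin.prod_univ_succ _
      have h2 : (MzvTuple.consEquiv k ks p).head = p.1.1 := rfl
      rw [h1, h2, ENNReal.coe_mul, mul_right_comm]
    simp only [hterm]
    refine (tsum_subtype {p : ℕ × MzvTuple ks | p.2.head < p.1} (fun p : ℕ × MzvTuple ks =>
      ((1 / (p.1 : ℝ≥0) ^ k : ℝ≥0) : ℝ≥0∞) * g p.1 * (p.2.term : ℝ≥0∞))).trans ?_
    rw [ENNReal.tsum_prod']
    refine tsum_congr fun n => ?_
    have hind : ∀ t : MzvTuple ks,
        Set.indicator {p : ℕ × MzvTuple ks | p.2.head < p.1} (fun p : ℕ × MzvTuple ks =>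
          ((1 / (p.1 : ℝ≥0) ^ k : ℝ≥0) : ℝ≥0∞) * g p.1 * (p.2.term : ℝ≥0∞)) (n, t) =
        ((1 / (n : ℝ≥0) ^ k : ℝ≥0) : ℝ≥0∞) * g n *
          ((t.term : ℝ≥0∞) * if t.head < n then 1 else 0) := by
      intro t
      rw [Set.indicator_apply]
      by_cases h : t.head < n <;> simp [h]
    simp only [hind]
    rw [ENNReal.tsum_mul_left, ih (fun m => if m < n then 1 else 0),
      tsum_eq_sum (s := Finset.range n) (fun m hm => by
        rw [if_neg (by simpa using hm), mul_zero]),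
      Finset.sum_congr rfl (fun m hm => by rw [if_pos (Finset.mem_range.mp hm), mul_one]),
      ← ENNReal.ofNNReal_finsetSum, mul_right_comm, ← ENNReal.coe_mul, mzvCoeff]
    congr 2
    ring

lemma mzv_eq (k : List ℕ) : mzv k = (∑' n, (mzvCoeff k n : ℝ≥0∞)).toReal := by
  have h := tsum_mzvTuple k (fun _ => 1)
  simp only [mul_one] at h
  rw [← h, ENNReal.tsum_toReal_eq (fun _ => ENNReal.coe_ne_top), mzv]
  refine tsum_congr fun t => ?_
  simp [MzvTuple.term]

/-- The counter j records letters x already read, each owing a factor 1/n. The final y is essential,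
since `indexAux` discards trailing x's. -/
lemma mzvCoeff_indexAux (w : List Letter) (j n : ℕ) :
    mzvCoeff (indexAux j (w ++ [.y])) n = polylogCoeff (w ++ [.y]) n / (n : ℝ≥0) ^ j := by
  induction w generalizing j n with
  | nil =>
    simp only [List.nil_append, indexAux, mzvCoeff, polylogCoeff]
    rw [pow_succ', div_mul_eq_div_div]
  | cons a w ih =>
    cases a with
    | x =>
      simp only [List.cons_append, indexAux, polylogCoeff]
      rw [ih, pow_succ', div_mul_eq_div_div]
    | y =>
      simp only [List.cons_append, indexAux, mzvCoeff, polylogCoeff]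
      simp only [ih, pow_zero, div_one]
      rw [pow_succ', div_mul_eq_div_div]

lemma mzv_index (w : List Letter) :
    mzv (index (w ++ [.y])) = (∑' n, (polylogCoeff (w ++ [.y]) n : ℝ≥0∞)).toReal := by
  rw [mzv_eq]
  simp only [index, mzvCoeff_indexAux, pow_zero, div_one]

/-! ### Convergence -/

lemma sum_le_of_le_div_sqrt {a : ℕ → ℝ≥0} {C : ℝ≥0} (h0 : a 0 ≤ 1)
    (h : ∀ n, a (n + 1) ≤ C / NNReal.sqrt (n + 1)) (n : ℕ) :
    ∑ m ∈ Finset.range (n + 1), (a m : ℝ) ≤ 1 + 2 * C * √n := by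
  induction n with
  | zero => simpa using h0
  | succ n ih =>
    rw [Finset.sum_range_succ]
    have h1 : (a (n + 1) : ℝ) ≤ C / √((n : ℝ) + 1) := by
      have := NNReal.coe_le_coe.mpr (h n)
      simpa using this
    have hs : 0 < √((n : ℝ) + 1) := Real.sqrt_pos.mpr (by positivity)
    have h2 : 1 / √((n : ℝ) + 1) ≤ 2 * √((n : ℝ) + 1) - 2 * √n := by
      rw [div_le_iff₀ hs]
      have e1 := Real.mul_self_sqrt (show (0 : ℝ) ≤ n + 1 by positivity)
      have e2 := Real.mul_self_sqrt (show (0 : ℝ) ≤ n by positivity)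
      nlinarith [sq_nonneg (√((n : ℝ) + 1) - √n)]
    have h3 : (C : ℝ) / √((n : ℝ) + 1) ≤ C * (2 * √((n : ℝ) + 1) - 2 * √n) := by
      rw [div_eq_mul_one_div]
      exact mul_le_mul_of_nonneg_left h2 C.coe_nonneg
    push_cast
    linarith

/-- An n^(-1/2) bound is crude but survives both letters; one more x improves it to the summable
n^(-3/2). -/
lemma polylogCoeff_le (w : List Letter) :
    ∃ C : ℝ≥0, ∀ n : ℕ, polylogCoeff w (n + 1) ≤ C / NNReal.sqrt (n + 1) := by
  induction w with
  | nil => exact ⟨0, fun n => by simp [polylogCoeff]⟩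
  | cons a w ih =>
    obtain ⟨C, hC⟩ := ih
    cases a with
    | x =>
      refine ⟨C, fun n => le_trans ?_ (hC n)⟩
      rw [polylogCoeff]
      exact div_le_self zero_le (by simp)
    | y =>
      refine ⟨1 + 2 * C, fun n => ?_⟩
      have h0 : polylogCoeff w 0 ≤ 1 := by rw [polylogCoeff_zero]; split_ifs <;> simp
      have h := sum_le_of_le_div_sqrt h0 hC n
      rw [polylogCoeff, ← NNReal.coe_le_coe]
      push_cast
      have hs : 1 ≤ √((n : ℝ) + 1) := Real.one_le_sqrt.mpr (by linarith [n.cast_nonneg (α := ℝ)])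
      have hs' : √(n : ℝ) ≤ √((n : ℝ) + 1) := Real.sqrt_le_sqrt (by linarith)
      have e1 := Real.mul_self_sqrt (show (0 : ℝ) ≤ n + 1 by positivity)
      calc (∑ m ∈ Finset.range (n + 1), (polylogCoeff w m : ℝ)) / ((n : ℝ) + 1)
          ≤ (1 + 2 * C * √n) / ((n : ℝ) + 1) := by gcongr
        _ ≤ (√((n : ℝ) + 1) + 2 * C * √((n : ℝ) + 1)) / ((n : ℝ) + 1) := by gcongr
        _ = (1 + 2 * C) / √((n : ℝ) + 1) := by
          rw [div_eq_div_iff (by positivity) (by positivity)]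
          linear_combination (1 + 2 * (C : ℝ)) * e1

lemma summable_polylogCoeff (w : List Letter) :
    Summable fun n => (polylogCoeff (.x :: w) n : ℝ) := by
  obtain ⟨C, hC⟩ := polylogCoeff_le w
  have hs := ((Real.summable_one_div_nat_rpow (p := 3 / 2)).mpr (by norm_num)).mul_left (C : ℝ)
  refine Summable.of_nonneg_of_le (fun n => NNReal.coe_nonneg _) (fun n => ?_) hs
  rcases n with _ | n
  · simp [polylogCoeff]
  · have h := NNReal.coe_le_coe.mpr (hC n)
    have hp : (0 : ℝ) < (n : ℝ) + 1 := by positivity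
    rw [polylogCoeff]
    push_cast at h ⊢
    have e : ((n : ℝ) + 1) ^ (3 / 2 : ℝ) = √((n : ℝ) + 1) * ((n : ℝ) + 1) := by
      rw [Real.sqrt_eq_rpow, ← Real.rpow_add_one hp.ne']
      norm_num
    rw [e, mul_one_div, ← div_div]
    gcongr

lemma hasSum_polylogCoeff (u : List Letter) :
    HasSum (fun n => (polylogCoeff (.x :: u ++ [.y]) n : ℝ)) (mzv (index (.x :: u ++ [.y]))) := by
  have h := (summable_polylogCoeff (u ++ [.y])).hasSum
  rw [← List.cons_append] at h
  rw [mzv_index, ENNReal.tsum_toReal_eq (fun _ => ENNReal.coe_ne_top)]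
  simpa only [ENNReal.coe_toReal] using h

lemma mzv_index_dual (u : List Letter) :
    mzv (index (.x :: u ++ [.y])) = mzv (index ((Letter.x :: u ++ [Letter.y]).map swap).reverse) := by
  have h : ((Letter.x :: u ++ [Letter.y]).map swap).reverse =
      (Letter.x :: (u.map swap).reverse) ++ [Letter.y] := by simp [swap]
  rw [mzv_index, tsum_polylogCoeff_dual, h, mzv_index]

/-! ### Multiple polylogarithms as power series -/

/-- The Taylor series of multiple polylogarithms, extended linearly from words. -/
def polylog : Poly →ₗ[ℂ] PowerSeries ℂ :=
  linExt fun w => PowerSeries.mk fun n => ((polylogCoeff w n : ℝ) : ℂ)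

lemma coeff_polylog_word (w : List Letter) (n : ℕ) :
    PowerSeries.coeff n (polylog (word w)) = ((polylogCoeff w n : ℝ) : ℂ) := by
  rw [polylog, linExt_word, PowerSeries.coeff_mk]

/-- The Euler derivation `t d/dt` on power series. -/
def eulerDer : Derivation ℂ (PowerSeries ℂ) (PowerSeries ℂ) :=
  (PowerSeries.X : PowerSeries ℂ) • PowerSeries.derivative ℂ

lemma coeff_eulerDer (F : PowerSeries ℂ) (n : ℕ) :
    PowerSeries.coeff n (eulerDer F) = n * PowerSeries.coeff n F := by
  rw [eulerDer, Derivation.smul_apply, smul_eq_mul]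
  cases n with
  | zero => simp
  | succ n =>
    rw [PowerSeries.coeff_succ_X_mul, PowerSeries.coeff_derivative]
    push_cast
    ring

lemma eq_of_eulerDer {F G : PowerSeries ℂ}
    (h0 : PowerSeries.coeff 0 F = PowerSeries.coeff 0 G) (h : eulerDer F = eulerDer G) :
    F = G := by
  ext n
  rcases eq_or_ne n 0 with rfl | hn
  · exact h0
  · have := congrArg (PowerSeries.coeff n) h
    rw [coeff_eulerDer, coeff_eulerDer] at this
    exact mul_left_cancel₀ (Nat.cast_ne_zero.mpr hn) this

/-- The power series `t / (1 - t)`. -/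
def geometric : PowerSeries ℂ := PowerSeries.mk fun n => if n = 0 then 0 else 1

lemma coeff_geometric_mul (F : PowerSeries ℂ) (n : ℕ) :
    PowerSeries.coeff n (geometric * F) =
      ∑ m ∈ Finset.range n, PowerSeries.coeff m F := by
  rw [mul_comm, PowerSeries.coeff_mul, Finset.Nat.sum_antidiagonal_eq_sum_range_succ
    (fun i j => PowerSeries.coeff i F * PowerSeries.coeff j geometric), Finset.sum_range_succ]
  have h0 : PowerSeries.coeff (n - n) geometric = 0 := by simp [geometric]
  rw [h0, mul_zero, add_zero]
  refine Finset.sum_congr rfl fun m hm => ?_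
  have : n - m ≠ 0 := by have := Finset.mem_range.mp hm; omega
  simp [geometric, this]

lemma coeff_zero_polylog (f : Poly) :
    PowerSeries.coeff 0 (polylog f) = wordCoeff [] f := by
  have : PowerSeries.coeff 0 ∘ₗ polylog = wordCoeff [] := by
    refine linearMap_ext fun w => ?_
    rw [LinearMap.comp_apply, coeff_polylog_word, polylogCoeff_zero, wordCoeff_word]
    split_ifs <;> simp
  exact LinearMap.congr_fun this f

/-- These are the polylogarithm equations for t d/dt. The constant is subtracted because the Euler
derivation kills constant terms; it is the coefficient of the word x, so it vanishes when no word
ends in x. -/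
lemma eulerDer_polylog (f : Poly) :
    eulerDer (polylog f) = polylog (leftD .x f) - PowerSeries.C (wordCoeff [] (leftD .x f)) +
      geometric * polylog (leftD .y f) := by
  refine poly_induction (P := fun f => eulerDer (polylog f) = polylog (leftD .x f) -
    PowerSeries.C (wordCoeff [] (leftD .x f)) + geometric * polylog (leftD .y f)) f ?_ ?_ ?_
  · intro w
    ext n
    rw [coeff_eulerDer, coeff_polylog_word, map_add, map_sub, coeff_geometric_mul]
    rcases w with _ | ⟨_ | _, w⟩
    · rcases eq_or_ne n 0 with rfl | hn <;> simp [polylogCoeff, *]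
    · rw [leftD_cons, if_pos rfl, leftD_cons, if_neg (by simp), wordCoeff_word,
        coeff_polylog_word, PowerSeries.coeff_C, polylogCoeff]
      rcases eq_or_ne n 0 with rfl | hn
      · rw [polylogCoeff_zero]
        by_cases hw : w = [] <;> simp [hw]
      · have hn' : (n : ℂ) ≠ 0 := Nat.cast_ne_zero.mpr hn
        push_cast
        rw [mul_div_cancel₀ _ hn']
        simp [hn]
    · rw [leftD_cons, if_neg (by simp), leftD_cons, if_pos rfl, polylogCoeff]
      simp only [coeff_polylog_word]
      rcases eq_or_ne n 0 with rfl | hn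
      · simp
      · have hn' : (n : ℂ) ≠ 0 := Nat.cast_ne_zero.mpr hn
        push_cast
        rw [mul_div_cancel₀ _ hn']
        simp
  · intro f g hf hg
    simp only [map_add, hf, hg, mul_add]
    ring
  · intro c f hf
    simp only [map_smul, Derivation.map_smul, hf, smul_add, smul_sub, mul_smul_comm]
    congr 2
    rw [smul_eq_mul, map_mul, ← PowerSeries.smul_eq_C_mul]

lemma eulerDer_polylog_of_rightD {f : Poly} (hf : rightD .x f = 0) :
    eulerDer (polylog f) = polylog (leftD .x f) + geometric * polylog (leftD .y f) := by
  rw [eulerDer_polylog, ← wordCoeff_nil_rightD, hf, map_zero, map_zero, sub_zero]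

/-- Both sides have the same constant term and, by induction on total length, the same Euler
derivative. Removing a first letter keeps the hypotheses because it commutes with `rightD .x`. -/
lemma polylog_shuffle_word (u v : List Letter) (hu : rightD .x (word u) = 0)
    (hv : rightD .x (word v) = 0) :
    polylog (shuffle (word u) (word v)) = polylog (word u) * polylog (word v) := by
  induction hn : u.length + v.length using Nat.strong_induction_on generalizing u v with
  | _ n ih =>
    have hl : ∀ a, polylog (shuffle (leftD a (word u)) (word v)) =
        polylog (leftD a (word u)) * polylog (word v) := by
      intro a
      have h := congrArg (leftD a) hu
      rw [leftD_rightD, map_zero] at h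
      rcases u with _ | ⟨b, u⟩
      · simp
      · rw [leftD_cons] at h ⊢
        split_ifs with hb
        · rw [if_pos hb] at h
          exact ih _ (by simp only [List.length_cons] at hn; omega) u v h hv rfl
        · simp
    have hr : ∀ a, polylog (shuffle (word u) (leftD a (word v))) =
        polylog (word u) * polylog (leftD a (word v)) := by
      intro a
      have h := congrArg (leftD a) hv
      rw [leftD_rightD, map_zero] at h
      rcases v with _ | ⟨b, v⟩
      · simp
      · rw [leftD_cons] at h ⊢
        split_ifs with hb
        · rw [if_pos hb] at h
          exact ih _ (by simp only [List.length_cons] at hn; omega) u v hu h rfl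
        · simp
    refine eq_of_eulerDer ?_ ?_
    · rw [coeff_zero_polylog, wordCoeff_nil_shuffle, ← coeff_zero_polylog, ← coeff_zero_polylog]
      simp
    · rw [eulerDer_polylog_of_rightD (by simp [rightD_shuffle, hu, hv]), Derivation.leibniz,
        eulerDer_polylog_of_rightD hu, eulerDer_polylog_of_rightD hv, leftD_shuffle,
        leftD_shuffle, map_add, map_add, hl, hl, hr, hr, smul_eq_mul, smul_eq_mul]
      ring

/-! ### Values at `1` -/

lemma h0_induction {P : Poly → Prop} {f : Poly} (hf : f ∈ h0) (nil : P (word []))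
    (word : ∀ u, P (word (.x :: u ++ [.y]))) (add : ∀ f g, P f → P g → P (f + g))
    (smul : ∀ (c : ℂ) f, P f → P (c • f)) : P f := by
  obtain ⟨g, hg, _, ⟨p, rfl⟩, rfl⟩ := Submodule.mem_sup.mp hf
  obtain ⟨c, rfl⟩ := Submodule.mem_span_singleton.mp hg
  refine add _ _ (smul _ _ nil) ?_
  rw [LinearMap.mulLeftRight_apply]
  refine poly_induction (P := fun p => P (letter .x * p * letter .y)) p ?_ ?_ ?_
  · intro w
    rw [← word_cons]
    exact (word_append _ _) ▸ word w
  · intro f g hf hg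
    rw [mul_add, add_mul]
    exact add _ _ hf hg
  · intro c f hf
    rw [mul_smul_comm, smul_mul_assoc]
    exact smul _ _ hf

lemma polylog_shuffle {f g : Poly} (hf : f ∈ h0) (hg : g ∈ h0) :
    polylog (shuffle f g) = polylog f * polylog g := by
  have hnil : rightD .x (word []) = 0 := rightD_nil _
  have hword : ∀ u, rightD .x (word (.x :: u ++ [.y])) = 0 := fun u => by
    rw [rightD_concat, if_neg (by simp)]
  have key : ∀ u, rightD .x (word u) = 0 → polylog (shuffle (word u) g) =
      polylog (word u) * polylog g := by
    intro u hu
    refine h0_induction (P := fun g => polylog (shuffle (word u) g) =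
      polylog (word u) * polylog g) hg (polylog_shuffle_word _ _ hu hnil)
      (fun v => polylog_shuffle_word _ _ hu (hword v)) ?_ ?_
    · intro f g hf hg
      rw [map_add, map_add, map_add, mul_add, hf, hg]
    · intro c f hf
      rw [map_smul, map_smul, map_smul, mul_smul_comm, hf]
  refine h0_induction (P := fun f => polylog (shuffle f g) = polylog f * polylog g) hf
    (key _ hnil) (fun v => key _ (hword v)) ?_ ?_
  · intro f g hf hg
    rw [map_add, map_add, LinearMap.add_apply, map_add, add_mul, hf, hg]
  · intro c f hf
    rw [map_smul, LinearMap.smul_apply, map_smul, map_smul, smul_mul_assoc, hf]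

/-- The linear extension to `𝔥` of the multiple zeta values of words. -/
def zetaExt : Poly →ₗ[ℂ] ℂ := linExt fun w => (mzv (index w) : ℂ)

lemma zetaHat_apply (f : h0) : zetaHat f = zetaExt f := rfl

lemma zetaExt_word (w : List Letter) : zetaExt (word w) = (mzv (index w) : ℂ) := linExt_word _ _

lemma mzv_nil : mzv [] = 1 := by
  have h : ∑' n, (mzvCoeff [] n : ENNReal) = 1 := by
    rw [tsum_eq_single 0 (fun n hn => by simp [mzvCoeff, hn])]
    simp [mzvCoeff]
  rw [mzv_eq, h, ENNReal.toReal_one]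

lemma hasSum_polylog {f : Poly} (hf : f ∈ h0) :
    Summable (fun n => ‖PowerSeries.coeff n (polylog f)‖) ∧
      HasSum (fun n => PowerSeries.coeff n (polylog f)) (zetaExt f) := by
  refine h0_induction (P := fun f => Summable (fun n => ‖PowerSeries.coeff n (polylog f)‖) ∧
      HasSum (fun n => PowerSeries.coeff n (polylog f)) (zetaExt f)) hf ?_ ?_ ?_ ?_
  · have h : ∀ n, PowerSeries.coeff n (polylog (word [])) = if n = 0 then 1 else 0 := by
      intro n
      rw [coeff_polylog_word, polylogCoeff]
      split_ifs <;> simp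
    simp only [h]
    refine ⟨summable_of_ne_finset_zero (s := {0}) fun n hn => ?_, ?_⟩
    · rw [if_neg (by simpa using hn), norm_zero]
    · have := hasSum_ite_eq (0 : ℕ) (1 : ℂ)
      rwa [zetaExt_word, index, indexAux, mzv_nil, Complex.ofReal_one]
  · intro u
    simp only [coeff_polylog_word, zetaExt_word]
    have h := hasSum_polylogCoeff u
    refine ⟨?_, Complex.hasSum_ofReal.mpr h⟩
    simpa using h.summable
  · rintro f g ⟨hf, hf'⟩ ⟨hg, hg'⟩
    simp only [map_add]
    exact ⟨(hf.add hg).of_nonneg_of_le (fun _ => norm_nonneg _) (fun _ => norm_add_le _ _),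
      hf'.add hg'⟩
  · rintro c f ⟨hf, hf'⟩
    simp only [map_smul, norm_smul]
    exact ⟨hf.mul_left _, hf'.const_smul c⟩

/-- Absolute convergence at t = 1 allows the Cauchy product, so the power series identity can be
summed directly. -/
lemma zetaExt_shuffle {f g : Poly} (hf : f ∈ h0) (hg : g ∈ h0) :
    zetaExt (shuffle f g) = zetaExt f * zetaExt g := by
  obtain ⟨hf1, hf2⟩ := hasSum_polylog hf
  obtain ⟨hg1, hg2⟩ := hasSum_polylog hg
  rw [← (hasSum_polylog (shuffle_mem_h0 hf hg)).2.tsum_eq, ← hf2.tsum_eq, ← hg2.tsum_eq,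
    tsum_mul_tsum_eq_tsum_sum_antidiagonal_of_summable_norm hf1 hg1, polylog_shuffle hf hg]
  exact tsum_congr fun n => PowerSeries.coeff_mul _ _ _

lemma zetaExt_tau {f : Poly} (hf : f ∈ h0) : zetaExt (tau f) = zetaExt f := by
  refine h0_induction (P := fun f => zetaExt (tau f) = zetaExt f) hf ?_ ?_ ?_ ?_
  · rw [tau_word]
    rfl
  · intro u
    rw [tau_word, zetaExt_word, zetaExt_word, mzv_index_dual]
  · intro f g hf hg
    rw [map_add, map_add, map_add, hf, hg]
  · intro c f hf
    rw [map_smul, map_smul, map_smul, hf]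

/-! ### The associator -/

/-- The regularized multiple zeta values, as a linear functional on `𝔥`. -/
def zetaReg : Poly →ₗ[ℂ] ℂ where
  toFun f := zetaHat (reg f)
  map_add' f g := by
    have h := reg_linear 1 f g
    rw [one_smul, one_smul] at h
    rw [h, map_add]
  map_smul' c f := by
    have h := reg_linear c f 0
    have h0 : reg 0 = 0 := Subtype.ext (reg_of_mem_h0 h0.zero_mem)
    rw [add_zero, h0, add_zero] at h
    rw [h, map_smul, RingHom.id_apply]

lemma zetaReg_apply (f : Poly) : zetaReg f = zetaHat (reg f) := rfl

lemma zetaReg_shuffle (f g : Poly) : zetaReg (shuffle f g) = zetaReg f * zetaReg g := by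
  simp only [zetaReg_apply, zetaHat_apply, reg_shuffle]
  exact zetaExt_shuffle (reg f).2 (reg g).2

lemma zetaReg_one : zetaReg 1 = 1 := by
  have h1 : (1 : Poly) ∈ h0 := by
    rw [mem_h0_iff]
    simp
  rw [zetaReg_apply, zetaHat_apply, reg_of_mem_h0 h1, ← word_nil, zetaExt_word]
  simp [index, indexAux, mzv_nil]

/-- The generalized duality formula. -/
lemma zetaReg_tau (f : Poly) : zetaReg (tau f) = zetaReg f := by
  simp only [zetaReg_apply, zetaHat_apply, reg_tau]
  exact zetaExt_tau (reg f).2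

namespace Series

lemma mul_apply (F G : Series) (w : List Letter) :
    (F * G) w = ∑ i ∈ Finset.range (w.length + 1), F (w.take i) * G (w.drop i) := rfl

lemma one_apply (w : List Letter) : (1 : Series) w = if w = [] then 1 else 0 := rfl

lemma neg_var_mul_apply (l : Letter) (F : Series) (w : List Letter) :
    (-var l * F) w = if w.head? = some l then -F w.tail else 0 := by
  have hvar : ∀ v : List Letter, (-var l) v = if v = [l] then -1 else 0 := by
    intro v
    change -(var l v) = _
    rw [var]
    split_ifs <;> simp
  rw [mul_apply]
  simp only [hvar]
  rcases w with _ | ⟨a, w⟩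
  · simp
  · rw [Finset.sum_eq_single 1]
    · by_cases h : a = l <;> simp [h]
    · intro i hi hi1
      rw [if_neg, zero_mul]
      intro h
      have h2 := congrArg List.length h
      have h3 := Finset.mem_range.mp hi
      simp only [List.length_take, List.length_cons, List.length_nil, zero_add] at h2 h3
      omega
    · intro h
      simp at h

/-- Each letter is replaced by a signed letter, so a word evaluates to one signed word and the sum
in `subst` has at most one nonzero term. -/
lemma evalWord_neg_apply (w v : List Letter) :
    evalWord (-Y) (-X) w v = if w = v.map swap then (-1) ^ v.length else 0 := by
  induction w generalizing v with
  | nil =>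
    rw [evalWord, one_apply]
    cases v <;> simp
  | cons a w ih =>
    have h : evalWord (-Y) (-X) (a :: w) = -var (swap a) * evalWord (-Y) (-X) w := by
      cases a <;> rfl
    rw [h, neg_var_mul_apply]
    rcases v with _ | ⟨b, v⟩
    · simp
    · simp only [List.head?_cons, Option.some.injEq, List.tail_cons, ih, List.map_cons,
        List.cons.injEq, List.length_cons, pow_succ]
      have hab : b = swap a ↔ a = swap b := by rw [eq_comm, swap_eq_iff]
      by_cases h1 : a = swap b <;> by_cases h2 : w = v.map swap <;> simp [hab, h1, h2, swap_swap]

lemma subst_neg_apply (F : Series) (v : List Letter) :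
    F.subst (-Y) (-X) v = (-1) ^ v.length * F (v.map swap) := by
  rw [subst, finsum_eq_single _ (v.map swap)]
  · rw [evalWord_neg_apply, if_pos rfl, mul_comm]
  · intro w hw
    rw [evalWord_neg_apply, if_neg hw, mul_zero]

/-- A series with constant term `1` is left cancellable. -/
lemma eq_of_mul_eq_mul_left {F G H : Series} (hF : F [] = 1) (h : F * G = F * H) : G = H := by
  funext w
  induction hn : w.length using Nat.strong_induction_on generalizing w with
  | _ n ih =>
    have hw := congrFun h w
    -- The term i = 0 isolates the coefficient at w itself; the others involve shorter suffixes,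
    -- where the series already agree.
    rw [mul_apply, mul_apply, Finset.sum_range_succ', Finset.sum_range_succ',
      Finset.sum_congr rfl (fun i hi => by
        rw [ih (w.drop (i + 1)).length
          (by have := Finset.mem_range.mp hi; rw [List.length_drop]; omega) _ rfl])] at hw
    simpa [hF] using hw

end Series

/-- The inverse of a group-like series is given by the antipode. -/
lemma phiKZ_mul_antipode :
    phiKZ * (show Series from fun v => (-1) ^ v.length * phiKZ v.reverse) = 1 := by
  funext w
  have hphi : ∀ v, phiKZ v = zetaReg (word v) := fun v => rfl
  have hsum : (phiKZ * (show Series from fun v => (-1) ^ v.length * phiKZ v.reverse)) w =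
      zetaReg (antipodeSum w) := by
    rw [Series.mul_apply, antipodeSum, map_sum]
    refine Finset.sum_congr rfl fun i _ => ?_
    rw [map_smul, zetaReg_shuffle, smul_eq_mul, hphi]
    simp only [hphi, List.length_drop]
    ring
  rw [hsum, Series.one_apply]
  split_ifs with hw
  · subst hw
    simp [antipodeSum, word_nil, one_shuffle, zetaReg_one]
  · rw [antipodeSum_eq_zero w hw, map_zero]

lemma phiKZ_mul_eq_one_iff :
    phiKZ * phiKZ.subst (-Series.Y) (-Series.X) = 1 ↔
      ∀ w : List Letter, zetaHat (reg (word w)) = zetaHat (reg (tau (word w))) := by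
  have hsub : phiKZ.subst (-Series.Y) (-Series.X) =
      fun v => (-1) ^ v.length * phiKZ (v.map swap) := funext (Series.subst_neg_apply phiKZ)
  have htau : ∀ w : List Letter, zetaHat (reg (tau (word w))) = phiKZ (w.map swap).reverse := by
    intro w
    rw [tau_word]
    rfl
  constructor
  · intro h w
    -- Two right inverses of φ_KZ coincide. Reading them at the reversed word turns the antipode
    -- coefficient into the one at w and the exchanged one into that at τ(w).
    have h2 := congrFun (Series.eq_of_mul_eq_mul_left (zetaReg_one : phiKZ [] = 1)
      (h.trans phiKZ_mul_antipode.symm)) w.reverse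
    rw [hsub] at h2
    have h3 := mul_left_cancel₀ (pow_ne_zero _ (neg_ne_zero.mpr one_ne_zero)) h2
    rw [List.reverse_reverse, List.map_reverse] at h3
    rw [htau, h3]
    rfl
  · intro h
    have h2 : phiKZ.subst (-Series.Y) (-Series.X) =
        (show Series from fun v => (-1) ^ v.length * phiKZ v.reverse) := by
      rw [hsub]
      funext v
      have h3 := (h v.reverse).trans (htau v.reverse)
      rw [List.map_reverse, List.reverse_reverse] at h3
      change _ = (-1) ^ v.length * zetaHat (reg (word v.reverse))
      rw [h3]
    rw [h2, phiKZ_mul_antipode]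

end KZ

end

theorem mainTheorem5 :
    KZ.phiKZ * KZ.phiKZ.subst (-KZ.Series.Y) (-KZ.Series.X) = 1 ∧
      (KZ.phiKZ * KZ.phiKZ.subst (-KZ.Series.Y) (-KZ.Series.X) = 1 ↔
        ∀ w : List KZ.Letter,
          KZ.zetaHat (KZ.reg (KZ.word w)) = KZ.zetaHat (KZ.reg (KZ.tau (KZ.word w)))) :=
  ⟨KZ.phiKZ_mul_eq_one_iff.mpr fun w => (KZ.zetaReg_tau (KZ.word w)).symm,
    KZ.phiKZ_mul_eq_one_iff⟩
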